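/- **Setting.** For $\Delta>0$ let $\mathcal{Q}_\Delta(a)=\Delta\big(\lfloor a/\Delta\rfloor+\tfrac12\big)$, applied entrywise to vectors. Let $x_1,\dots,x_n$ be i.i.d. copies of a zero-mean random vector $x\in\mathbb{R}^d$, $d\ge 2$, with $\Sigma^\star=\mathbb{E}(xx^\top)$, and suppose that $\mathbb{E}|v^\top x|^4\le M$ for every $v\in\mathbb{R}^d$ with $\|v\|_2=1$. Let $\tau_1,\dots,\tau_n$ be i.i.d., independent of $x_1,\dots,x_n$, each distributed as the sum of two independent random vectors uniform on $[-\frac\Delta2,\frac\Delta2]^d$ (triangular dither). For a threshold $\zeta>0$ put $$\check x_k=\frac{x_k}{\|x_k\|_4}\min\{\|x_k\|_4,\zeta\}\ \ (\check x_k=0\text{ if }x_k=0),\qquad \dot x_k=\mathcal{Q}_\Delta(\check x_k+\tau_k),\qquad \widehat\Sigma=\frac1n\sum_{k=1}^n\dot x_k\dot x_k^\top-\frac{\Delta^2}{4}I_d ,$$ where $\|x\|_4=(\sum_i|x_i|^4)^{1/4}$, and let $\|\cdot\|_{op}$ denote the operator norm with respect to the Euclidean norm. **Theorem.** For all constants $c_0,c_1,c_2>0$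 there is a constant $C>0$, depending only on $c_0,c_1,c_2$, such that the following holds for all $d\ge2$, $n$, $\delta>0$, $\Delta>0$, $M$ and all distributions of $x$ as above. If $$c_1\,(M^{1/4}+\Delta)\Big(\frac{n}{\delta\log d}\Big)^{1/4}\le\zeta\le c_2\,(M^{1/4}+\Delta)\Big(\frac{n}{\delta\log d}\Big)^{1/4}\qquad\text{and}\qquad n\ge c_0\,\delta d\log d,$$ then $$\mathbb{P}\Big(\|\widehat\Sigma-\Sigma^\star\|_{op}\ge C_\delta\,\big(\sqrt M+\Delta^2\big)\sqrt{\frac{\delta d\log d}{n}}\Big)\le 2d^{-\delta},\qquad C_\delta:=C\max\{1,1/\delta\}.$$ In particular the constant is independent of $\delta$ when $\delta\ge1$. -/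

import Mathlib

open MeasureTheory ProbabilityTheory

namespace QCE

/-- The uniform quantizer with level `Δ > 0` of a real number. -/
noncomputable def quantize (Δ a : ℝ) : ℝ := Δ * ((⌊a / Δ⌋ : ℝ) + 1 / 2)

/-- The `ℓ₄` norm of a vector. -/
noncomputable def l4norm {d : ℕ} (x : Fin d → ℝ) : ℝ := (∑ i, |x i| ^ 4) ^ ((1 : ℝ) / 4)

/-- The `ℓ₄` truncation `(x / ‖x‖₄) · min (‖x‖₄, ζ)`; the zero vector is sent to itself. -/
noncomputable def truncate {d : ℕ} (ζ : ℝ) (x : Fin d → ℝ) : Fin d → ℝ :=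
  (min (l4norm x) ζ / l4norm x) • x

/-- The uniform distribution on the cube `[-Δ/2, Δ/2]^d`. -/
noncomputable def uniformCube (d : ℕ) (Δ : ℝ) : Measure (Fin d → ℝ) :=
  ProbabilityTheory.cond volume (Set.Icc (fun _ => -(Δ / 2)) (fun _ => Δ / 2))

/-- The triangular dither: the law of the sum of two independent uniform vectors on the cube. -/
noncomputable def triangularDither (d : ℕ) (Δ : ℝ) : Measure (Fin d → ℝ) :=
  Measure.conv (uniformCube d Δ) (uniformCube d Δ)

/-- The quantized sample obtained from `x` with truncation threshold `ζ` and dither `τ`. -/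
noncomputable def quantizedSample {d : ℕ} (Δ ζ : ℝ) (x τ : Fin d → ℝ) : Fin d → ℝ :=
  fun i => quantize Δ (truncate ζ x i + τ i)

/-- The estimator: sample second-moment matrix of the quantized samples minus `(Δ² / 4) I`. -/
noncomputable def estimator {n d : ℕ} (Δ ζ : ℝ) (x τ : Fin n → Fin d → ℝ) :
    Matrix (Fin d) (Fin d) ℝ :=
  (1 / (n : ℝ)) • (∑ k, Matrix.vecMulVec (quantizedSample Δ ζ (x k) (τ k))
      (quantizedSample Δ ζ (x k) (τ k))) -
    (Δ ^ 2 / 4) • (1 : Matrix (Fin d) (Fin d) ℝ)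

/-- The matrix `E (x xᵀ)` for a random vector `x` with law `P`. -/
noncomputable def secondMoment {d : ℕ} (P : Measure (Fin d → ℝ)) : Matrix (Fin d) (Fin d) ℝ :=
  Matrix.of fun i j => ∫ x, x i * x j ∂P

/-- The operator norm of a square matrix with respect to the Euclidean norm. -/
noncomputable def opNorm {d : ℕ} (A : Matrix (Fin d) (Fin d) ℝ) : ℝ :=
  ‖Matrix.toEuclideanCLM (𝕜 := ℝ) A‖

end QCE

/-! Condition on `x` and write the quantized sample as `x̌ + ε`. Because the dither is a sum of two
independent uniforms, the entries of `ε` are independent, almost surely at most `3Δ/2` in absolute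
value, of mean zero and of variance exactly `Δ²/4`, whatever `x̌` is. Hence `E ẋẋᵀ = E x̌x̌ᵀ +
(Δ²/4) I`: the correction in the estimator cancels the quantization exactly, and the error is an
average of centered i.i.d. matrices plus a pure truncation bias (`estimator_sub_eq`).

The bias lives on `‖x‖₄ > ζ`, where fourth moments bound it by `M√d/ζ²`
(`norm_truncatedSecondMoment_sub_le`). The average is treated by a matrix Bernstein inequality
(`measure_norm_sum_ge_le`), which needs two inputs. The almost sure bound `2√d ζ² + (9/2) d Δ²` on
each summand profits from the `ℓ₄` truncation, which costs only `√d`. The variance bound, of order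
`d (M + Δ⁴)`, is free of `ζ`, since `ε` is subgaussian with a dimension-free constant in every
direction (`integral_dotProduct_ditherError_pow_four_le`).

Bernstein itself follows the Ahlswede–Winter route: bound the expected trace of the exponential of
the sum, peel off one summand at a time by Golden–Thompson (`trace_exp_add_le`), and use `e^x ≤ 1 +
x + x²` on `[-1, 1]`. Finally `exists_temperature` picks the scale `θ` making the exponent at most
`-(1 + δ) log d`; the extra `log d` pays for the dimension factor in front. -/

namespace QCE

open scoped Matrix.Norms.L2Operator

/-! ### Trace inequalities and Golden–Thompson -/

section GoldenThompson

variable {m : Type*} [Fintype m]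

lemma trace_mul_le_half (P Q : Matrix m m ℝ) :
    (P * Q).trace ≤ ((P * P.transpose).trace + (Q.transpose * Q).trace) / 2 := by
  simp only [Matrix.trace, Matrix.diag, Matrix.mul_apply, Matrix.transpose_apply]
  rw [← Finset.sum_add_distrib, Finset.sum_div]
  refine Finset.sum_le_sum fun i _ => ?_
  rw [← Finset.sum_add_distrib, Finset.sum_div]
  exact Finset.sum_le_sum fun j _ => by nlinarith [sq_nonneg (P i j - Q j i)]

variable [DecidableEq m]

lemma trace_mul_pow_comm (A B : Matrix m m ℝ) (k : ℕ) :
    ((A * B) ^ k).trace = ((B * A) ^ k).trace := by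
  cases k with
  | zero => simp
  | succ k =>
    have h : SemiconjBy B (A * B) (B * A) := by
      simp [SemiconjBy, mul_assoc]
    rw [pow_succ, ← mul_assoc, Matrix.trace_mul_comm, ← mul_assoc, (h.pow_right k).eq, mul_assoc,
      ← pow_succ]

/-- The two claims feed each other. The first at `k + 1` is the second at `k` for `Z = PQ`, followed
by the first for `P²` and `Q²`. The second at `k + 1` is the second at `k` for `Z²`, then the first
for `ZZᵀ` and `ZᵀZ`, then the AM-GM bound, whose two terms agree by cyclicity. -/
lemma trace_pow_two_pow_aux (k : ℕ) :
    (∀ P Q : Matrix m m ℝ, P.transpose = P → Q.transpose = Q →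
      ((P * Q) ^ 2 ^ k).trace ≤ (P ^ 2 ^ k * Q ^ 2 ^ k).trace) ∧
    ∀ Z : Matrix m m ℝ, (Z ^ 2 ^ (k + 1)).trace ≤ ((Z * Z.transpose) ^ 2 ^ k).trace := by
  induction k with
  | zero =>
    refine ⟨fun P Q _ _ => by simp, fun Z => ?_⟩
    have h := trace_mul_le_half Z Z
    rw [Matrix.trace_mul_comm Z.transpose] at h
    simpa [pow_two] using h
  | succ k ih =>
    obtain ⟨ihS, ihW⟩ := ih
    refine ⟨fun P Q hP hQ => ?_, fun Z => ?_⟩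
    · calc ((P * Q) ^ 2 ^ (k + 1)).trace ≤ (((P * Q) * (P * Q).transpose) ^ 2 ^ k).trace := ihW _
        _ = (((P * (Q * Q)) * P) ^ 2 ^ k).trace := by
          rw [Matrix.transpose_mul, hP, hQ]; simp only [mul_assoc]
        _ = ((P ^ 2 * Q ^ 2) ^ 2 ^ k).trace := by
          rw [trace_mul_pow_comm]; simp only [pow_two, mul_assoc]
        _ ≤ ((P ^ 2) ^ 2 ^ k * (Q ^ 2) ^ 2 ^ k).trace := by
          exact ihS _ _ (by rw [Matrix.transpose_pow, hP]) (by rw [Matrix.transpose_pow, hQ])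
        _ = _ := by rw [← pow_mul, ← pow_mul, pow_succ' 2 k]
    · have hs : ∀ W : Matrix m m ℝ, W.transpose = W → (W ^ 2 ^ k).transpose = W ^ 2 ^ k :=
        fun W hW => by rw [Matrix.transpose_pow, hW]
      have e1 : (Z.transpose * Z).transpose = Z.transpose * Z := by simp
      have e2 : (Z * Z.transpose).transpose = Z * Z.transpose := by simp
      calc (Z ^ 2 ^ (k + 1 + 1)).trace = ((Z ^ 2) ^ 2 ^ (k + 1)).trace := by
            rw [← pow_mul, pow_succ' 2 (k + 1)]
        _ ≤ ((Z ^ 2 * (Z ^ 2).transpose) ^ 2 ^ k).trace := ihW _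
        _ = ((Z * (Z * (Z.transpose * Z.transpose))) ^ 2 ^ k).trace := by
          rw [Matrix.transpose_pow]; simp only [pow_two, mul_assoc]
        _ = (((Z * Z.transpose) * (Z.transpose * Z)) ^ 2 ^ k).trace := by
          rw [trace_mul_pow_comm]
          have : Z * (Z.transpose * Z.transpose) * Z =
              (Z * Z.transpose) * (Z.transpose * Z) := by simp only [mul_assoc]
          rw [this]
        _ ≤ ((Z * Z.transpose) ^ 2 ^ k * (Z.transpose * Z) ^ 2 ^ k).trace := ihS _ _ e2 e1
        _ ≤ _ := trace_mul_le_half _ _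
        _ = ((Z * Z.transpose) ^ 2 ^ (k + 1)).trace := by
          rw [hs _ e1, hs _ e2, ← pow_add, ← pow_add, trace_mul_pow_comm Z.transpose,
            ← two_mul (2 ^ k), ← pow_succ']
          ring

lemma norm_exp_le_exp_norm {𝔸 : Type*} [NormedRing 𝔸] [NormedAlgebra ℝ 𝔸] [CompleteSpace 𝔸]
    [NormOneClass 𝔸] (x : 𝔸) : ‖NormedSpace.exp x‖ ≤ Real.exp ‖x‖ := by
  have hs := NormedSpace.expSeries_div_summable (𝔸 := ℝ) ‖x‖
  rw [NormedSpace.exp_eq_tsum ℝ, Real.exp_eq_exp_ℝ, NormedSpace.exp_eq_tsum_div]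
  refine tsum_of_norm_bounded hs.hasSum fun n => ?_
  rw [norm_smul, norm_inv, div_eq_inv_mul, Real.norm_natCast]
  gcongr
  exact norm_pow_le x n

lemma norm_pow_sub_pow_le {𝔸 : Type*} [NormedRing 𝔸] [NormOneClass 𝔸] {X Y : 𝔸} {c : ℝ}
    (hX : ‖X‖ ≤ c) (hY : ‖Y‖ ≤ c) (hc : 1 ≤ c) (N : ℕ) :
    ‖X ^ N - Y ^ N‖ ≤ N * ‖X - Y‖ * c ^ N := by
  induction N with
  | zero => simp
  | succ N ih =>
    have e : X ^ (N + 1) - Y ^ (N + 1) = X * (X ^ N - Y ^ N) + (X - Y) * Y ^ N := by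
      rw [pow_succ', pow_succ']; noncomm_ring
    have h0 : 0 ≤ c := by linarith
    have h1 : ‖Y ^ N‖ ≤ c ^ (N + 1) :=
      ((norm_pow_le Y N).trans (pow_le_pow_left₀ (norm_nonneg _) hY N)).trans
        (pow_le_pow_right₀ hc N.le_succ)
    calc ‖X ^ (N + 1) - Y ^ (N + 1)‖ ≤ ‖X‖ * ‖X ^ N - Y ^ N‖ + ‖X - Y‖ * ‖Y ^ N‖ := by
          rw [e]; exact (norm_add_le _ _).trans (add_le_add (norm_mul_le _ _) (norm_mul_le _ _))
      _ ≤ c * (N * ‖X - Y‖ * c ^ N) + ‖X - Y‖ * c ^ (N + 1) := by gcongr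
      _ = _ := by push_cast; ring

/-- The Lie product formula. -/
lemma tendsto_exp_mul_exp_pow {𝔸 : Type*} [NormedRing 𝔸] [NormedAlgebra ℝ 𝔸] [CompleteSpace 𝔸]
    [NormOneClass 𝔸] (A B : 𝔸) :
    Filter.Tendsto (fun N : ℕ => (NormedSpace.exp ((N : ℝ)⁻¹ • A) *
      NormedSpace.exp ((N : ℝ)⁻¹ • B)) ^ N) Filter.atTop (nhds (NormedSpace.exp (A + B))) := by
  -- Both curves have velocity `A + B` at `0`, so a single factor is off by `o(1/N)`; telescoping
  -- the `N`-th power costs only a factor `N` times a bounded constant.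
  have hd : HasDerivAt (fun t : ℝ => NormedSpace.exp (t • A) * NormedSpace.exp (t • B) -
      NormedSpace.exp (t • (A + B))) 0 0 := by
    have h := ((hasDerivAt_exp_smul_const (𝕂 := ℝ) A (0 : ℝ)).mul
      (hasDerivAt_exp_smul_const (𝕂 := ℝ) B (0 : ℝ))).sub
      (hasDerivAt_exp_smul_const (𝕂 := ℝ) (A + B) (0 : ℝ))
    simpa [Pi.mul_def, Pi.sub_def] using h
  have hlim : Filter.Tendsto (fun N : ℕ => (N : ℝ) *
      ‖NormedSpace.exp ((N : ℝ)⁻¹ • A) * NormedSpace.exp ((N : ℝ)⁻¹ • B) -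
        NormedSpace.exp ((N : ℝ)⁻¹ • (A + B))‖ * Real.exp (‖A‖ + ‖B‖))
      Filter.atTop (nhds 0) := by
    have h1 := hd.tendsto_slope_zero_right.norm
    have h2 : Filter.Tendsto (fun N : ℕ => (N : ℝ)⁻¹) Filter.atTop (nhdsWithin 0 (Set.Ioi 0)) :=
      tendsto_inv_atTop_nhdsGT_zero.comp tendsto_natCast_atTop_atTop
    have h3 := (h1.comp h2).mul_const (Real.exp (‖A‖ + ‖B‖))
    rw [norm_zero, zero_mul] at h3
    refine h3.congr fun N => ?_
    simp [norm_smul]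
  rw [tendsto_iff_norm_sub_tendsto_zero]
  refine squeeze_zero' (Filter.Eventually.of_forall fun _ => norm_nonneg _) ?_ hlim
  filter_upwards [Filter.eventually_gt_atTop 0] with N hN
  have hN' : (N : ℝ) ≠ 0 := by positivity
  have hexp : NormedSpace.exp (A + B) = NormedSpace.exp ((N : ℝ)⁻¹ • (A + B)) ^ N := by
    let _ : NormedAlgebra ℚ 𝔸 := NormedAlgebra.restrictScalars ℚ ℝ 𝔸
    rw [← NormedSpace.exp_nsmul, ← Nat.cast_smul_eq_nsmul ℝ, smul_smul, mul_inv_cancel₀ hN',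
      one_smul]
  have hn : ∀ W : 𝔸, ‖NormedSpace.exp ((N : ℝ)⁻¹ • W)‖ ≤ Real.exp ((N : ℝ)⁻¹ * ‖W‖) := fun W =>
    (norm_exp_le_exp_norm _).trans_eq (by rw [norm_smul, norm_inv, Real.norm_natCast])
  have hc : Real.exp (‖A‖ + ‖B‖) = Real.exp ((N : ℝ)⁻¹ * (‖A‖ + ‖B‖)) ^ N := by
    rw [← Real.exp_nat_mul]; congr 1; field_simp
  rw [hexp, hc]
  refine norm_pow_sub_pow_le ?_ ?_ (Real.one_le_exp (by positivity)) N
  · rw [mul_add, Real.exp_add]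
    exact (norm_mul_le _ _).trans (mul_le_mul (hn A) (hn B) (norm_nonneg _) (by positivity))
  · refine (hn _).trans (Real.exp_le_exp.2 ?_)
    gcongr
    exact norm_add_le A B

/-- The Golden–Thompson inequality for real symmetric matrices. -/
theorem trace_exp_add_le {A B : Matrix m m ℝ} (hA : A.IsHermitian) (hB : B.IsHermitian) :
    (NormedSpace.exp (A + B)).trace ≤ (NormedSpace.exp A * NormedSpace.exp B).trace := by
  -- The unit of the algebra of empty matrices has norm `0`, so the Lie product formula applies only
  -- to nonempty index types.
  cases isEmpty_or_nonempty m
  · simp [Matrix.trace]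
  -- The trace inequality is available for powers of two only, so the limit is taken along `N = 2 ^
  -- k`.
  have h := (tendsto_exp_mul_exp_pow A B).comp
    (tendsto_pow_atTop_atTop_of_one_lt (one_lt_two (α := ℕ)))
  have hc : Continuous (fun W : Matrix m m ℝ => W.trace) := by fun_prop
  refine le_of_tendsto ((hc.tendsto _).comp h) (Filter.Eventually.of_forall fun k => ?_)
  have hs : ∀ W : Matrix m m ℝ, W.IsHermitian → ∀ c : ℝ,
      (NormedSpace.exp (c • W)).transpose = NormedSpace.exp (c • W) := by
    intro W hW c
    rw [← Matrix.exp_transpose, Matrix.transpose_smul]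
    congr 2
  refine ((trace_pow_two_pow_aux k).1 _ _ (hs A hA _) (hs B hB _)).trans_eq ?_
  have he : ∀ W : Matrix m m ℝ,
      NormedSpace.exp (((2 ^ k : ℕ) : ℝ)⁻¹ • W) ^ 2 ^ k = NormedSpace.exp W := by
    intro W
    rw [← Matrix.exp_nsmul, ← Nat.cast_smul_eq_nsmul ℝ, smul_smul, mul_inv_cancel₀ (by positivity),
      one_smul]
  rw [he, he]

end GoldenThompson

/-! ### Spectral calculus for real symmetric matrices -/

section Symmetric

variable {m : Type*} [Fintype m] [DecidableEq m]

/-- Orthogonal diagonalization of a real symmetric matrix. -/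
lemma exists_diagonalization {A : Matrix m m ℝ} (hA : A.IsHermitian) :
    ∃ (U : Matrix m m ℝ) (l : m → ℝ), U * U.transpose = 1 ∧ U.transpose * U = 1 ∧
      A = U * Matrix.diagonal l * U.transpose ∧ ‖A‖ = ‖l‖ := by
  have h := hA.spectral_theorem
  rw [Unitary.conjStarAlgAut_apply] at h
  refine ⟨hA.eigenvectorUnitary, hA.eigenvalues, ?_, ?_, ?_, ?_⟩
  · simpa [Matrix.star_eq_conjTranspose] using (Unitary.mul_star_self_of_mem hA.eigenvectorUnitary.2)
  · simpa [Matrix.star_eq_conjTranspose] using (Unitary.star_mul_self_of_mem hA.eigenvectorUnitary.2)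
  · simpa [Matrix.star_eq_conjTranspose] using h
  · conv_lhs => rw [h]
    rw [← Unitary.coe_star, CStarRing.norm_mul_coe_unitary, CStarRing.norm_coe_unitary_mul,
      Matrix.l2_opNorm_diagonal]
    rfl

lemma exp_conj_diagonal {U : Matrix m m ℝ} (l : m → ℝ) (h1 : U * U.transpose = 1)
    (h2 : U.transpose * U = 1) :
    NormedSpace.exp (U * Matrix.diagonal l * U.transpose) =
      U * Matrix.diagonal (fun i => Real.exp (l i)) * U.transpose := by
  have hU : U⁻¹ = U.transpose := Matrix.inv_eq_right_inv h1
  have hu : IsUnit U := ⟨⟨U, U.transpose, h1, h2⟩, rfl⟩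
  rw [← hU, Matrix.exp_conj U _ hu, Matrix.exp_diagonal]
  congr 3
  funext i
  rw [Pi.coe_exp, Real.exp_eq_exp_ℝ]

lemma trace_conj_diagonal {U : Matrix m m ℝ} (l : m → ℝ) (h2 : U.transpose * U = 1) :
    (U * Matrix.diagonal l * U.transpose).trace = ∑ i, l i := by
  rw [Matrix.trace_mul_comm, ← mul_assoc, h2, one_mul, Matrix.trace_diagonal]

lemma dotProduct_conj_diagonal (U : Matrix m m ℝ) (l v : m → ℝ) :
    v ⬝ᵥ ((U * Matrix.diagonal l * U.transpose).mulVec v) =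
      ∑ i, l i * (U.transpose.mulVec v i) ^ 2 := by
  rw [← Matrix.mulVec_mulVec, ← Matrix.mulVec_mulVec, Matrix.dotProduct_mulVec,
    ← Matrix.mulVec_transpose]
  simp only [dotProduct, Matrix.mulVec_diagonal]
  exact Finset.sum_congr rfl fun i _ => by ring

lemma dotProduct_conj_self {U : Matrix m m ℝ} (h1 : U * U.transpose = 1) (v : m → ℝ) :
    ∑ i, (U.transpose.mulVec v i) ^ 2 = v ⬝ᵥ v := by
  have := dotProduct_conj_diagonal U 1 v
  rw [show Matrix.diagonal (1 : m → ℝ) = 1 from Matrix.diagonal_one, mul_one, h1,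
    Matrix.one_mulVec] at this
  simp [this]

lemma norm_le_of_abs_dotProduct_mulVec_le {A : Matrix m m ℝ} (hA : A.IsHermitian) {c : ℝ}
    (hc : 0 ≤ c) (h : ∀ v : m → ℝ, v ⬝ᵥ v = 1 → |v ⬝ᵥ A.mulVec v| ≤ c) : ‖A‖ ≤ c := by
  obtain ⟨U, l, h1, h2, hA', hn⟩ := exists_diagonalization hA
  rw [hn, pi_norm_le_iff_of_nonneg hc]
  intro i
  have e : U.transpose.mulVec (U.mulVec (Pi.single i 1)) = Pi.single i 1 := by
    rw [Matrix.mulVec_mulVec, h2, Matrix.one_mulVec]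
  have h3 := h (U.mulVec (Pi.single i 1)) (by
    rw [← dotProduct_conj_self h1, e]; simp [Pi.single_apply])
  rw [hA', dotProduct_conj_diagonal, e] at h3
  simpa [Pi.single_apply] using h3

/-- Some eigenvalue attains the norm in absolute value; its sign decides which of the two traces
contains the required exponential, and all other terms are positive. -/
lemma exp_norm_le_trace_exp_add [Nonempty m] {A : Matrix m m ℝ} (hA : A.IsHermitian) :
    Real.exp ‖A‖ ≤ (NormedSpace.exp A).trace + (NormedSpace.exp (-A)).trace := by
  obtain ⟨U, l, h1, h2, hA', hn⟩ := exists_diagonalization hA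
  have hneg : -A = U * Matrix.diagonal (fun i => -l i) * U.transpose := by
    rw [hA', ← Matrix.diagonal_neg, mul_neg, neg_mul]
  rw [hneg, hn, hA', exp_conj_diagonal _ h1 h2, exp_conj_diagonal _ h1 h2,
    trace_conj_diagonal _ h2, trace_conj_diagonal _ h2]
  obtain ⟨i, hi⟩ := Finite.exists_max (fun i => ‖l i‖)
  have hle : ‖l‖ ≤ |l i| := (pi_norm_le_iff_of_nonneg (norm_nonneg _)).2 hi
  have hs : ∀ f : m → ℝ, Real.exp (f i) ≤ ∑ j, Real.exp (f j) := fun f =>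
    Finset.single_le_sum (f := fun j => Real.exp (f j)) (fun j _ => (Real.exp_pos _).le)
      (Finset.mem_univ i)
  have hp : ∀ f : m → ℝ, 0 ≤ ∑ j, Real.exp (f j) := fun f =>
    Finset.sum_nonneg fun j _ => (Real.exp_pos _).le
  refine (Real.exp_le_exp.2 hle).trans ?_
  rcases abs_cases (l i) with ⟨h, _⟩ | ⟨h, _⟩ <;> rw [h]
  · linarith [hs l, hp fun j => -l j]
  · linarith [hs fun j => -l j, hp l]

/-- In an eigenbasis this is `e^l ≤ 1 + l + l²` for `|l| ≤ 1`, weighted by squared coordinates of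
`v`. -/
lemma dotProduct_exp_mulVec_le {A : Matrix m m ℝ} (hA : A.IsHermitian) (hn : ‖A‖ ≤ 1)
    (v : m → ℝ) :
    v ⬝ᵥ (NormedSpace.exp A).mulVec v ≤
      v ⬝ᵥ v + v ⬝ᵥ A.mulVec v + (A.mulVec v) ⬝ᵥ (A.mulVec v) := by
  obtain ⟨U, l, h1, h2, hA', hn'⟩ := exists_diagonalization hA
  have hsq : (A.mulVec v) ⬝ᵥ (A.mulVec v) =
      v ⬝ᵥ (U * Matrix.diagonal (fun i => l i ^ 2) * U.transpose).mulVec v := by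
    have : U * Matrix.diagonal (fun i => l i ^ 2) * U.transpose = A * A := by
      have e : U * Matrix.diagonal l * U.transpose * (U * Matrix.diagonal l * U.transpose) =
          U * Matrix.diagonal l * (U.transpose * U) * Matrix.diagonal l * U.transpose := by
        simp only [mul_assoc]
      rw [hA', e, h2, mul_one, mul_assoc U (Matrix.diagonal l), Matrix.diagonal_mul_diagonal]
      simp only [pow_two]
    have hA'' : A.transpose = A := hA
    rw [this, ← Matrix.mulVec_mulVec, Matrix.dotProduct_mulVec v, ← Matrix.mulVec_transpose, hA'']
  rw [hsq, hA', exp_conj_diagonal _ h1 h2, dotProduct_conj_diagonal, dotProduct_conj_diagonal,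
    dotProduct_conj_diagonal, ← dotProduct_conj_self h1, ← Finset.sum_add_distrib,
    ← Finset.sum_add_distrib]
  refine Finset.sum_le_sum fun i _ => ?_
  have hl : |l i| ≤ 1 := (norm_le_pi_norm l i).trans (hn' ▸ hn)
  have he := (abs_le.1 (Real.abs_exp_sub_one_sub_id_le hl)).2
  nlinarith [sq_nonneg (U.transpose.mulVec v i)]

lemma trace_exp_mul_le {A N : Matrix m m ℝ} (hA : A.IsHermitian) {c : ℝ}
    (hN : ∀ v : m → ℝ, v ⬝ᵥ N.mulVec v ≤ c * (v ⬝ᵥ v)) :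
    (NormedSpace.exp A * N).trace ≤ c * (NormedSpace.exp A).trace := by
  -- With `exp A = BᵀB`, the trace against any matrix is the sum of its quadratic forms at the rows
  -- of `B`, so a bound on quadratic forms transfers termwise.
  set B := NormedSpace.exp ((1 / 2 : ℝ) • A) with hB
  have hBs : B.transpose = B := by
    rw [hB, ← Matrix.exp_transpose, Matrix.transpose_smul]
    congr 2
  have hBB : NormedSpace.exp A = B.transpose * B := by
    rw [hBs, ← pow_two, hB, ← Matrix.exp_nsmul, ← Nat.cast_smul_eq_nsmul ℝ, smul_smul]
    norm_num
  have key : ∀ L : Matrix m m ℝ, (B.transpose * B * L).trace = ∑ i, B i ⬝ᵥ L.mulVec (B i) := by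
    intro L
    rw [mul_assoc, Matrix.trace_mul_comm]
    refine Finset.sum_congr rfl fun i _ => ?_
    rw [Matrix.dotProduct_mulVec]
    rfl
  have h1 := key 1
  rw [mul_one] at h1
  rw [hBB, key, h1, Finset.mul_sum]
  refine Finset.sum_le_sum fun i _ => ?_
  rw [Matrix.one_mulVec]
  exact hN _

end Symmetric

/-! ### Matrix Bernstein inequality by the Ahlswede–Winter method -/

section Bernstein

variable {m : Type*} [Fintype m]

lemma dotProduct_mulVec_eq_sum (A : Matrix m m ℝ) (v : m → ℝ) :
    v ⬝ᵥ A.mulVec v = ∑ i, ∑ j, v i * v j * A i j := by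
  simp only [dotProduct, Matrix.mulVec, Finset.mul_sum]
  exact Finset.sum_congr rfl fun i _ => Finset.sum_congr rfl fun j _ => by ring

lemma integrable_dotProduct_mulVec {Ω : Type*} [MeasurableSpace Ω] {μ : Measure Ω}
    {Y : Ω → Matrix m m ℝ} (hY : ∀ i j, Integrable (fun ω => Y ω i j) μ) (v : m → ℝ) :
    Integrable (fun ω => v ⬝ᵥ (Y ω).mulVec v) μ := by
  simp only [dotProduct_mulVec_eq_sum]
  exact integrable_finsetSum _ fun i _ => integrable_finsetSum _ fun j _ => (hY i j).const_mul _

lemma integral_dotProduct_mulVec {Ω : Type*} [MeasurableSpace Ω] {μ : Measure Ω}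
    {Y : Ω → Matrix m m ℝ} (hY : ∀ i j, Integrable (fun ω => Y ω i j) μ) (v : m → ℝ) :
    ∫ ω, v ⬝ᵥ (Y ω).mulVec v ∂μ =
      v ⬝ᵥ (Matrix.of fun i j => ∫ ω, Y ω i j ∂μ).mulVec v := by
  simp only [dotProduct_mulVec_eq_sum]
  rw [integral_finsetSum _ fun i _ => integrable_finsetSum _ fun j _ => (hY i j).const_mul _]
  refine Finset.sum_congr rfl fun i _ => ?_
  rw [integral_finsetSum _ fun j _ => (hY i j).const_mul _]
  exact Finset.sum_congr rfl fun j _ => integral_const_mul _ _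

variable [DecidableEq m]

lemma abs_entry_le_norm (A : Matrix m m ℝ) (i j : m) : |A i j| ≤ ‖A‖ := by
  have h := Matrix.l2_opNorm_mulVec A (WithLp.toLp 2 (Pi.single j 1))
  have h2 := PiLp.norm_apply_le (WithLp.toLp 2 (A.mulVec (Pi.single j 1))) i
  have e : ‖(WithLp.toLp 2 (Pi.single j 1) : EuclideanSpace ℝ m)‖ = 1 := by simp
  rw [e, mul_one] at h
  simpa using h2.trans h

lemma measurable_exp_entry {Ω : Type*} [MeasurableSpace Ω] {f : Ω → Matrix m m ℝ}
    (hf : ∀ i j, Measurable fun ω => f ω i j) (i j : m) :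
    Measurable fun ω => NormedSpace.exp (f ω) i j := by
  let _ : NormedAlgebra ℚ (Matrix m m ℝ) := NormedAlgebra.restrictScalars ℚ ℝ _
  have hc : Continuous fun A : Matrix m m ℝ => NormedSpace.exp A i j :=
    (NormedSpace.exp_continuous (𝔸 := Matrix m m ℝ)).matrix_elem i j
  have hof : Continuous (Matrix.of : (m → m → ℝ) → Matrix m m ℝ) := by exact continuous_id
  exact (hc.comp hof).measurable.comp (measurable_pi_iff.2 fun i => measurable_pi_iff.2 fun j => hf i j)

variable {Ω E ι : Type*} [MeasurableSpace Ω] [MeasurableSpace E] {μ : Measure Ω}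
  [IsProbabilityMeasure μ]

/-- The second-order bound on `exp` is integrated: the linear term has mean zero and the quadratic
one is the variance. -/
lemma dotProduct_integral_exp_mulVec_le {X : Ω → Matrix m m ℝ} {q : ℝ}
    (hmeas : ∀ i j, Measurable fun ω => X ω i j) (hsym : ∀ ω, (X ω).IsHermitian)
    (hb : ∀ᵐ ω ∂μ, ‖X ω‖ ≤ 1) (hmean : ∀ i j, ∫ ω, X ω i j ∂μ = 0)
    (hvar : ∀ v : m → ℝ, ∫ ω, (X ω).mulVec v ⬝ᵥ (X ω).mulVec v ∂μ ≤ q * (v ⬝ᵥ v))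
    (v : m → ℝ) :
    v ⬝ᵥ (Matrix.of fun i j => ∫ ω, NormedSpace.exp (X ω) i j ∂μ).mulVec v ≤
      (1 + q) * (v ⬝ᵥ v) := by
  have hXi : ∀ i j, Integrable (fun ω => X ω i j) μ := fun i j =>
    Integrable.of_bound (hmeas i j).aestronglyMeasurable 1 (by
      filter_upwards [hb] with ω hω using (abs_entry_le_norm _ i j).trans hω)
  have hEi : ∀ i j, Integrable (fun ω => NormedSpace.exp (X ω) i j) μ := fun i j =>
    Integrable.of_bound (measurable_exp_entry hmeas i j).aestronglyMeasurable (Real.exp 1) (by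
      filter_upwards [hb] with ω hω
      cases isEmpty_or_nonempty m
      · exact isEmptyElim i
      exact (abs_entry_le_norm _ i j).trans ((norm_exp_le_exp_norm _).trans (Real.exp_le_exp.2 hω)))
  have hprod : ∀ i j k l, Integrable (fun ω => X ω i j * X ω k l) μ := fun i j k l =>
    (hXi k l).bdd_mul (c := 1) (hmeas i j).aestronglyMeasurable (by
      filter_upwards [hb] with ω hω using (abs_entry_le_norm _ i j).trans hω)
  have hsq : Integrable (fun ω => (X ω).mulVec v ⬝ᵥ (X ω).mulVec v) μ := by
    simp only [dotProduct, Matrix.mulVec, Finset.sum_mul_sum]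
    refine integrable_finsetSum _ fun i _ => integrable_finsetSum _ fun j _ =>
      integrable_finsetSum _ fun k _ => ?_
    exact ((hprod i j i k).const_mul (v j * v k)).congr
      (Filter.Eventually.of_forall fun ω => by simp only; ring)
  have hX0 : ∫ ω, v ⬝ᵥ (X ω).mulVec v ∂μ = 0 := by
    rw [integral_dotProduct_mulVec hXi]; simp [hmean, dotProduct, Matrix.mulVec]
  calc v ⬝ᵥ (Matrix.of fun i j => ∫ ω, NormedSpace.exp (X ω) i j ∂μ).mulVec v
      = ∫ ω, v ⬝ᵥ (NormedSpace.exp (X ω)).mulVec v ∂μ :=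
        (integral_dotProduct_mulVec hEi v).symm
    _ ≤ ∫ ω, (v ⬝ᵥ v + v ⬝ᵥ (X ω).mulVec v + (X ω).mulVec v ⬝ᵥ (X ω).mulVec v) ∂μ := by
        refine integral_mono_ae (integrable_dotProduct_mulVec hEi v)
          (((integrable_const _).add (integrable_dotProduct_mulVec hXi v)).add hsq) ?_
        filter_upwards [hb] with ω hω using dotProduct_exp_mulVec_le (hsym ω) hω v
    _ = v ⬝ᵥ v + ∫ ω, (X ω).mulVec v ⬝ᵥ (X ω).mulVec v ∂μ := by
        rw [integral_add (f := fun ω => v ⬝ᵥ v + v ⬝ᵥ (X ω).mulVec v)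
          ((integrable_const _).add (integrable_dotProduct_mulVec hXi v)) hsq,
          integral_add (integrable_const _) (integrable_dotProduct_mulVec hXi v), hX0]
        simp
    _ ≤ (1 + q) * (v ⬝ᵥ v) := by linarith [hvar v]

/-- Each summand contributes one factor `1 + q`: Golden–Thompson splits off its exponential, and
independence lets that exponential be replaced by its mean, whose quadratic form is at most `1 + q`.
The empty sum has trace equal to the dimension. -/
lemma integral_trace_exp_sum_le {ξ : ι → Ω → E} {G : E → Matrix m m ℝ} {q : ℝ} (hq : 0 ≤ q)
    (hξ : iIndepFun ξ μ) (hξm : ∀ k, Measurable (ξ k))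
    (hG : ∀ i j, Measurable fun e => G e i j) (hsym : ∀ e, (G e).IsHermitian)
    (hb : ∀ k, ∀ᵐ ω ∂μ, ‖G (ξ k ω)‖ ≤ 1) (hmean : ∀ k i j, ∫ ω, G (ξ k ω) i j ∂μ = 0)
    (hvar : ∀ k, ∀ v : m → ℝ,
      ∫ ω, (G (ξ k ω)).mulVec v ⬝ᵥ (G (ξ k ω)).mulVec v ∂μ ≤ q * (v ⬝ᵥ v))
    (s : Finset ι) :
    Integrable (fun ω => (NormedSpace.exp (∑ k ∈ s, G (ξ k ω))).trace) μ ∧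
    ∫ ω, (NormedSpace.exp (∑ k ∈ s, G (ξ k ω))).trace ∂μ ≤
      (1 + q) ^ s.card * Fintype.card m := by
  classical
  have hsm : ∀ (s : Finset ι) i j, Measurable fun p : s → E => (∑ k, G (p k)) i j := by
    intro s i j
    simp only [Matrix.sum_apply]
    exact Finset.measurable_fun_sum _ fun k _ => (hG i j).comp (measurable_pi_apply k)
  have hSG : ∀ (s : Finset ι) ω, ∑ k ∈ s, G (ξ k ω) = ∑ k : s, G (ξ k ω) := fun s ω =>
    (Finset.sum_coe_sort s fun k => G (ξ k ω)).symm
  have hSm : ∀ (s : Finset ι) i j,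
      Measurable fun ω => NormedSpace.exp (∑ k ∈ s, G (ξ k ω)) i j := by
    intro s i j
    simp only [hSG]
    exact (measurable_exp_entry (hsm s) i j).comp
      (measurable_pi_iff.2 fun k => hξm k)
  have hSi : ∀ (s : Finset ι) i j,
      Integrable (fun ω => NormedSpace.exp (∑ k ∈ s, G (ξ k ω)) i j) μ := by
    intro s i j
    refine Integrable.of_bound (hSm s i j).aestronglyMeasurable (Real.exp s.card) ?_
    have hall : ∀ᵐ ω ∂μ, ∀ k ∈ s, ‖G (ξ k ω)‖ ≤ 1 :=
      (Filter.eventually_all_finset s).2 fun k _ => hb k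
    filter_upwards [hall] with ω hω
    cases isEmpty_or_nonempty m
    · exact isEmptyElim i
    refine (abs_entry_le_norm _ i j).trans ((norm_exp_le_exp_norm _).trans (Real.exp_le_exp.2 ?_))
    refine (norm_sum_le _ _).trans ((Finset.sum_le_sum hω).trans_eq (by simp))
  have hTi : ∀ s : Finset ι,
      Integrable (fun ω => (NormedSpace.exp (∑ k ∈ s, G (ξ k ω))).trace) μ := fun s =>
    integrable_finsetSum _ fun i _ => hSi s i i
  have hSsym : ∀ (s : Finset ι) ω, (∑ k ∈ s, G (ξ k ω)).IsHermitian := fun s ω => by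
    induction s using Finset.induction_on with
    | empty => simp
    | insert k s hk ih => rw [Finset.sum_insert hk]; exact (hsym _).add ih
  refine ⟨hTi s, ?_⟩
  induction s using Finset.induction_on with
  | empty => simp
  | insert k s hk ih =>
    set N : Matrix m m ℝ := Matrix.of fun i j => ∫ ω, NormedSpace.exp (G (ξ k ω)) i j ∂μ with hN
    have hNq : ∀ v : m → ℝ, v ⬝ᵥ N.mulVec v ≤ (1 + q) * (v ⬝ᵥ v) :=
      dotProduct_integral_exp_mulVec_le (fun i j => (hG i j).comp (hξm k)) (fun ω => hsym _)
        (hb k) (hmean k) (hvar k)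
    have hsing : ∀ i j, Integrable (fun ω => NormedSpace.exp (G (ξ k ω)) i j) μ := fun i j => by
      simpa using hSi {k} i j
    have hind : ∀ i j i' j', IndepFun (fun ω => NormedSpace.exp (∑ k ∈ s, G (ξ k ω)) i j)
        (fun ω => NormedSpace.exp (G (ξ k ω)) i' j') μ := by
      intro i j i' j'
      have h := (hξ.indepFun_finset s {k} (by simpa using hk) hξm).comp
        (measurable_exp_entry (hsm s) i j)
        ((measurable_exp_entry hG i' j').comp
          (measurable_pi_apply (⟨k, Finset.mem_singleton_self k⟩ : ({k} : Finset ι))))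
      simp only [hSG]
      exact h
    have hmul : ∀ i j i' j', Integrable (fun ω => NormedSpace.exp (∑ k ∈ s, G (ξ k ω)) i j *
        NormedSpace.exp (G (ξ k ω)) i' j') μ := fun i j i' j' =>
      (hind i j i' j').integrable_mul (hSi s i j) (hsing i' j')
    have hmulI : ∀ i j i' j', ∫ ω, NormedSpace.exp (∑ k ∈ s, G (ξ k ω)) i j *
        NormedSpace.exp (G (ξ k ω)) i' j' ∂μ =
        ∫ ω, NormedSpace.exp (∑ k ∈ s, G (ξ k ω)) i j * N i' j' ∂μ := fun i j i' j' => by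
      rw [integral_mul_const]
      exact (hind i j i' j').integral_fun_mul_eq_mul_integral (hSi s i j).aestronglyMeasurable
        (hsing i' j').aestronglyMeasurable
    have hprodI : Integrable (fun ω => (NormedSpace.exp (∑ k ∈ s, G (ξ k ω)) *
        NormedSpace.exp (G (ξ k ω))).trace) μ := by
      simp only [Matrix.trace, Matrix.diag, Matrix.mul_apply]
      exact integrable_finsetSum _ fun i _ => integrable_finsetSum _ fun j _ => hmul i j j i
    have hprodN : Integrable (fun ω => (NormedSpace.exp (∑ k ∈ s, G (ξ k ω)) * N).trace) μ := by
      simp only [Matrix.trace, Matrix.diag, Matrix.mul_apply]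
      exact integrable_finsetSum _ fun i _ => integrable_finsetSum _ fun j _ =>
        (hSi s i j).mul_const _
    calc ∫ ω, (NormedSpace.exp (∑ k ∈ insert k s, G (ξ k ω))).trace ∂μ
        ≤ ∫ ω, (NormedSpace.exp (∑ k ∈ s, G (ξ k ω)) * NormedSpace.exp (G (ξ k ω))).trace ∂μ := by
          refine integral_mono (hTi _) hprodI fun ω => ?_
          simp only
          rw [Finset.sum_insert hk, add_comm]
          exact trace_exp_add_le (hSsym s ω) (hsym _)
      _ = ∫ ω, (NormedSpace.exp (∑ k ∈ s, G (ξ k ω)) * N).trace ∂μ := by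
          simp only [Matrix.trace, Matrix.diag, Matrix.mul_apply]
          rw [integral_finsetSum _ fun i _ => integrable_finsetSum _ fun j _ => hmul i j j i,
            integral_finsetSum _ fun i _ => integrable_finsetSum _ fun j _ =>
              (hSi s i j).mul_const _]
          refine Finset.sum_congr rfl fun i _ => ?_
          rw [integral_finsetSum _ fun j _ => hmul i j j i,
            integral_finsetSum _ fun j _ => (hSi s i j).mul_const _]
          exact Finset.sum_congr rfl fun j _ => hmulI i j j i
      _ ≤ ∫ ω, (1 + q) * (NormedSpace.exp (∑ k ∈ s, G (ξ k ω))).trace ∂μ :=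
          integral_mono hprodN ((hTi s).const_mul _) fun ω => trace_exp_mul_le (hSsym s ω) hNq
      _ ≤ (1 + q) * ((1 + q) ^ s.card * Fintype.card m) := by
          rw [integral_const_mul]
          gcongr
      _ = (1 + q) ^ (insert k s).card * Fintype.card m := by
          rw [Finset.card_insert_of_notMem hk]; ring

/-- A matrix Bernstein inequality, in exponential form. -/
theorem measure_norm_sum_ge_le [Nonempty m] [Fintype ι] {ξ : ι → Ω → E} {G : E → Matrix m m ℝ}
    {q : ℝ} (hq : 0 ≤ q)
    (hξ : iIndepFun ξ μ) (hξm : ∀ k, Measurable (ξ k))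
    (hG : ∀ i j, Measurable fun e => G e i j) (hsym : ∀ e, (G e).IsHermitian)
    (hb : ∀ k, ∀ᵐ ω ∂μ, ‖G (ξ k ω)‖ ≤ 1) (hmean : ∀ k i j, ∫ ω, G (ξ k ω) i j ∂μ = 0)
    (hvar : ∀ k, ∀ v : m → ℝ,
      ∫ ω, (G (ξ k ω)).mulVec v ⬝ᵥ (G (ξ k ω)).mulVec v ∂μ ≤ q * (v ⬝ᵥ v)) (t : ℝ) :
    μ.real {ω | t ≤ ‖∑ k, G (ξ k ω)‖} ≤
      2 * Fintype.card m * Real.exp (Fintype.card ι * q - t) := by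
  classical
  obtain ⟨hi1, h1⟩ := integral_trace_exp_sum_le hq hξ hξm hG hsym hb hmean hvar Finset.univ
  obtain ⟨hi2, h2⟩ := integral_trace_exp_sum_le (G := fun e => -G e) hq hξ hξm
    (fun i j => (hG i j).neg) (fun e => (hsym e).neg) (by simpa using hb)
    (fun k i j => by simp [integral_neg, hmean])
    (by simpa [Matrix.neg_mulVec] using hvar) Finset.univ
  have hSsym : ∀ ω, (∑ k, G (ξ k ω)).IsHermitian := fun ω => by
    rw [Matrix.IsHermitian, Matrix.conjTranspose_sum]
    exact Finset.sum_congr rfl fun k _ => hsym _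
  have hpt : ∀ ω, Real.exp ‖∑ k, G (ξ k ω)‖ ≤ (NormedSpace.exp (∑ k, G (ξ k ω))).trace +
      (NormedSpace.exp (∑ k, -G (ξ k ω))).trace := fun ω => by
    rw [Finset.sum_neg_distrib]
    exact exp_norm_le_trace_exp_add (hSsym ω)
  -- Markov at level `e^t`. No inverse temperature appears because it is to be absorbed into `G`,
  -- normalized to norm at most `1`.
  have hmk := mul_meas_ge_le_integral_of_nonneg (μ := μ)
    (Filter.Eventually.of_forall fun ω => (Real.exp_pos _).le.trans (hpt ω)) (hi1.add hi2)
    (Real.exp t)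
  have hsub : μ.real {ω | t ≤ ‖∑ k, G (ξ k ω)‖} ≤ μ.real {ω | Real.exp t ≤
      (NormedSpace.exp (∑ k, G (ξ k ω))).trace + (NormedSpace.exp (∑ k, -G (ξ k ω))).trace} :=
    measureReal_mono fun ω hω => (Real.exp_le_exp.2 hω).trans (hpt ω)
  have hpow : (1 + q) ^ (Finset.univ : Finset ι).card ≤ Real.exp (Fintype.card ι * q) := by
    rw [Real.exp_nat_mul, Finset.card_univ]
    exact pow_le_pow_left₀ (by linarith) (by linarith [Real.add_one_le_exp q]) _
  have hint := integral_add hi1 hi2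
  rw [hint] at hmk
  have hc : (0 : ℝ) ≤ Fintype.card m := by positivity
  have hfin : Real.exp t * μ.real {ω | t ≤ ‖∑ k, G (ξ k ω)‖} ≤
      2 * Fintype.card m * Real.exp (Fintype.card ι * q) := by
    have := mul_le_mul_of_nonneg_left hsub (Real.exp_pos t).le
    have := mul_le_mul_of_nonneg_right hpow hc
    linarith
  rw [Real.exp_sub, mul_div_assoc', le_div_iff₀ (Real.exp_pos t)]
  linarith

end Bernstein

/-! ### Triangular dither in one dimension -/

section Dither

/-- The uniform distribution on `[-Δ/2, Δ/2]`. -/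
noncomputable def uniformInterval (Δ : ℝ) : Measure ℝ :=
  ProbabilityTheory.cond volume (Set.Icc (-(Δ / 2)) (Δ / 2))

/-- The triangular distribution on `[-Δ, Δ]`. -/
noncomputable def triangular (Δ : ℝ) : Measure ℝ :=
  Measure.conv (uniformInterval Δ) (uniformInterval Δ)

/-- The quantization error `𝒬(s) - s`. -/
noncomputable def quantizeError (Δ s : ℝ) : ℝ := quantize Δ s - s

variable {Δ : ℝ}

lemma isProbabilityMeasure_uniformInterval (hΔ : 0 < Δ) :
    IsProbabilityMeasure (uniformInterval Δ) :=
  cond_isProbabilityMeasure_of_finite (by simp [hΔ]) (by simp)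

lemma isProbabilityMeasure_triangular (hΔ : 0 < Δ) : IsProbabilityMeasure (triangular Δ) := by
  have := isProbabilityMeasure_uniformInterval hΔ
  unfold triangular
  infer_instance

lemma uniformCube_eq_pi (d : ℕ) (hΔ : 0 < Δ) :
    uniformCube d Δ = Measure.pi fun _ : Fin d => uniformInterval Δ := by
  have := isProbabilityMeasure_uniformInterval hΔ
  refine (Measure.pi_eq fun s hs => ?_).symm
  have hm : MeasurableSet (Set.Icc (fun _ : Fin d => -(Δ / 2)) (fun _ => Δ / 2)) :=
    measurableSet_Icc
  simp only [uniformCube, uniformInterval]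
  rw [cond_apply hm]
  simp_rw [cond_apply measurableSet_Icc]
  rw [← Set.pi_univ_Icc, ← Set.pi_inter_distrib, volume_pi, Measure.pi_pi, Measure.pi_pi,
    Finset.prod_mul_distrib, ENNReal.prod_inv_distrib]
  intro i _ j _ _
  right
  simp

lemma triangularDither_eq_pi (d : ℕ) (hΔ : 0 < Δ) :
    triangularDither d Δ = Measure.pi fun _ : Fin d => triangular Δ := by
  have := isProbabilityMeasure_uniformInterval hΔ
  have := isProbabilityMeasure_triangular hΔ
  unfold triangularDither
  rw [uniformCube_eq_pi d hΔ]
  have h := measurePreserving_arrowProdEquivProdArrow ℝ ℝ (Fin d)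
    (fun _ => uniformInterval Δ) (fun _ => uniformInterval Δ)
  have h2 := Measure.pi_map_pi (μ := fun _ : Fin d => (uniformInterval Δ).prod (uniformInterval Δ))
    (f := fun _ (z : ℝ × ℝ) => z.1 + z.2) (fun _ => by fun_prop)
  unfold Measure.conv
  rw [← h.map_eq, Measure.map_map (by fun_prop) h.measurable]
  exact h2

lemma measurable_quantize (Δ : ℝ) : Measurable (quantize Δ) := by
  unfold quantize
  have : Measurable fun a : ℝ => ((⌊a / Δ⌋ : ℤ) : ℝ) :=
    measurable_from_top.comp (Int.measurable_floor.comp (measurable_id.div_const Δ))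
  fun_prop

lemma measurable_quantizeError (Δ : ℝ) : Measurable (quantizeError Δ) :=
  (measurable_quantize Δ).sub measurable_id

lemma abs_quantizeError_le (hΔ : 0 < Δ) (s : ℝ) : |quantizeError Δ s| ≤ Δ / 2 := by
  have h1 := Int.floor_le (s / Δ)
  have h2 := (Int.lt_floor_add_one (s / Δ)).le
  rw [le_div_iff₀ hΔ] at h1
  rw [div_le_iff₀ hΔ] at h2
  rw [abs_le]
  unfold quantizeError quantize
  constructor <;> nlinarith

lemma periodic_quantizeError (hΔ : 0 < Δ) : Function.Periodic (quantizeError Δ) Δ := by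
  intro s
  unfold quantizeError quantize
  rw [add_div, div_self hΔ.ne', Int.floor_add_one]
  push_cast
  ring

lemma quantizeError_of_mem (hΔ : 0 < Δ) {s : ℝ} (h0 : 0 ≤ s) (h1 : s < Δ) :
    quantizeError Δ s = Δ / 2 - s := by
  have : ⌊s / Δ⌋ = 0 := by
    rw [Int.floor_eq_iff]
    constructor
    · simpa using div_nonneg h0 hΔ.le
    · simpa [div_lt_one hΔ] using h1
  simp [quantizeError, quantize, this]
  ring

lemma integral_uniformInterval (hΔ : 0 < Δ) (f : ℝ → ℝ) :
    ∫ v, f v ∂(uniformInterval Δ) = Δ⁻¹ * ∫ v in (-(Δ / 2))..(Δ / 2), f v := by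
  rw [intervalIntegral.integral_of_le (by linarith), ← integral_Icc_eq_integral_Ioc]
  unfold uniformInterval ProbabilityTheory.cond
  rw [integral_smul_measure, Real.volume_Icc, ENNReal.toReal_inv, ENNReal.toReal_ofReal (by linarith)]
  norm_num

lemma ae_uniformInterval (Δ : ℝ) : ∀ᵐ v ∂(uniformInterval Δ), |v| ≤ Δ / 2 := by
  have h := ae_cond_mem (μ := (volume : Measure ℝ))
    (measurableSet_Icc (a := -(Δ / 2)) (b := Δ / 2))
  filter_upwards [h] with v hv using abs_le.2 hv

/-- The quantization error is a sawtooth of period `Δ`, and a uniform shift averages over exactly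
one period. The offset `b` therefore disappears, which is what makes the moments of the error
independent of the signal. -/
lemma integral_comp_quantizeError (hΔ : 0 < Δ) (g : ℝ → ℝ) (b : ℝ) :
    ∫ v, g (quantizeError Δ (b + v)) ∂(uniformInterval Δ) =
      Δ⁻¹ * ∫ s in (0 : ℝ)..Δ, g (Δ / 2 - s) := by
  rw [integral_uniformInterval hΔ]
  congr 1
  have hper : Function.Periodic (fun s => g (quantizeError Δ s)) Δ := fun s => by
    simp only [periodic_quantizeError hΔ s]
  rw [intervalIntegral.integral_comp_add_left (fun s => g (quantizeError Δ s)) b]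
  have h := hper.intervalIntegral_add_eq (b + -(Δ / 2)) 0
  rw [zero_add, show b + -(Δ / 2) + Δ = b + Δ / 2 by ring] at h
  rw [h]
  refine intervalIntegral.integral_congr_ae ?_
  -- The sawtooth jumps at `s = Δ`, so the explicit formula fails at that one point.
  have hne : ∀ᵐ s : ℝ, s ≠ Δ := by simp [ae_iff]
  filter_upwards [hne] with s hs hmem
  rw [Set.uIoc_of_le hΔ.le] at hmem
  rw [quantizeError_of_mem hΔ hmem.1.le (lt_of_le_of_ne hmem.2 hs)]

lemma integral_quantizeError (hΔ : 0 < Δ) (b : ℝ) :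
    ∫ v, quantizeError Δ (b + v) ∂(uniformInterval Δ) = 0 := by
  rw [integral_comp_quantizeError hΔ (fun s => s) b]
  rw [intervalIntegral.integral_comp_sub_left (fun s => s), integral_id]
  ring

lemma integral_quantizeError_sq (hΔ : 0 < Δ) (b : ℝ) :
    ∫ v, quantizeError Δ (b + v) ^ 2 ∂(uniformInterval Δ) = Δ ^ 2 / 12 := by
  rw [integral_comp_quantizeError hΔ (fun s => s ^ 2) b,
    intervalIntegral.integral_comp_sub_left (fun s => s ^ 2), integral_pow]
  field_simp
  ring

lemma integral_id_uniformInterval (hΔ : 0 < Δ) : ∫ v, v ∂(uniformInterval Δ) = 0 := by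
  rw [integral_uniformInterval hΔ, integral_id]; ring

lemma integral_sq_uniformInterval (hΔ : 0 < Δ) : ∫ v, v ^ 2 ∂(uniformInterval Δ) = Δ ^ 2 / 12 := by
  rw [integral_uniformInterval hΔ, integral_pow]
  field_simp
  ring

lemma integrable_uniformInterval_prod (hΔ : 0 < Δ) {h : ℝ × ℝ → ℝ} (hm : Measurable h) (C : ℝ)
    (hC : ∀ z : ℝ × ℝ, |z.1| ≤ Δ / 2 → |z.2| ≤ Δ / 2 → |h z| ≤ C) :
    Integrable h ((uniformInterval Δ).prod (uniformInterval Δ)) := by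
  have := isProbabilityMeasure_uniformInterval hΔ
  refine Integrable.of_bound hm.aestronglyMeasurable C ?_
  have h1 : ∀ᵐ z ∂((uniformInterval Δ).prod (uniformInterval Δ)), |z.1| ≤ Δ / 2 :=
    Measure.quasiMeasurePreserving_fst.ae (ae_uniformInterval Δ)
  have h2 : ∀ᵐ z ∂((uniformInterval Δ).prod (uniformInterval Δ)), |z.2| ≤ Δ / 2 :=
    Measure.quasiMeasurePreserving_snd.ae (ae_uniformInterval Δ)
  filter_upwards [h1, h2] with z hz1 hz2 using hC z hz1 hz2

/-- The total error `𝒬(a + t) - a` of the dithered quantizer. -/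
noncomputable def ditherError (Δ a t : ℝ) : ℝ := quantize Δ (a + t) - a

lemma measurable_ditherError_right (Δ a : ℝ) : Measurable fun t : ℝ => ditherError Δ a t := by
  unfold ditherError
  exact ((measurable_quantize Δ).comp (by fun_prop)).sub (by fun_prop)

lemma ditherError_eq (a t : ℝ) : ditherError Δ a t = t + quantizeError Δ (a + t) := by
  unfold ditherError quantizeError; ring

lemma integral_triangular (Δ : ℝ) {f : ℝ → ℝ} (hf : Measurable f) :
    ∫ t, f t ∂(triangular Δ) =
      ∫ z : ℝ × ℝ, f (z.1 + z.2) ∂((uniformInterval Δ).prod (uniformInterval Δ)) := by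
  unfold triangular Measure.conv
  rw [integral_map (by fun_prop) hf.aestronglyMeasurable]

lemma ae_abs_ditherError_le (hΔ : 0 < Δ) (a : ℝ) :
    ∀ᵐ t ∂(triangular Δ), |ditherError Δ a t| ≤ 3 * Δ / 2 := by
  have := isProbabilityMeasure_uniformInterval hΔ
  have hm := measurable_ditherError_right Δ a
  unfold triangular Measure.conv
  rw [ae_map_iff (by fun_prop) (measurableSet_le hm.abs measurable_const)]
  have h1 : ∀ᵐ z ∂((uniformInterval Δ).prod (uniformInterval Δ)), |z.1| ≤ Δ / 2 :=
    Measure.quasiMeasurePreserving_fst.ae (ae_uniformInterval Δ)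
  have h2 : ∀ᵐ z ∂((uniformInterval Δ).prod (uniformInterval Δ)), |z.2| ≤ Δ / 2 :=
    Measure.quasiMeasurePreserving_snd.ae (ae_uniformInterval Δ)
  filter_upwards [h1, h2] with z hz1 hz2
  rw [ditherError_eq]
  have h3 := abs_le.1 (abs_quantizeError_le hΔ (a + (z.1 + z.2)))
  have h4 := abs_le.1 hz1
  have h5 := abs_le.1 hz2
  exact abs_le.2 ⟨by linarith, by linarith⟩

lemma integral_ditherError (hΔ : 0 < Δ) (a : ℝ) :
    ∫ t, ditherError Δ a t ∂(triangular Δ) = 0 := by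
  have := isProbabilityMeasure_uniformInterval hΔ
  have hq := measurable_quantizeError Δ
  rw [integral_triangular Δ (measurable_ditherError_right Δ a)]
  simp only [ditherError_eq]
  have i1 : Integrable (fun z : ℝ × ℝ => z.1) ((uniformInterval Δ).prod (uniformInterval Δ)) :=
    integrable_uniformInterval_prod hΔ (by fun_prop) (Δ / 2) fun z h _ => h
  have i2 : Integrable (fun z : ℝ × ℝ => z.2) ((uniformInterval Δ).prod (uniformInterval Δ)) :=
    integrable_uniformInterval_prod hΔ (by fun_prop) (Δ / 2) fun z _ h => h
  have i3 : Integrable (fun z : ℝ × ℝ => quantizeError Δ (a + (z.1 + z.2)))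
      ((uniformInterval Δ).prod (uniformInterval Δ)) :=
    integrable_uniformInterval_prod hΔ (hq.comp (by fun_prop)) (Δ / 2) fun z _ _ =>
      abs_quantizeError_le hΔ _
  rw [integral_add (i1.fun_add i2) i3, integral_add i1 i2, integral_prod _ i1, integral_prod _ i2,
    integral_prod _ i3]
  simp [← add_assoc, integral_quantizeError hΔ, integral_id_uniformInterval hΔ]

/-- The error is the sum of the two uniforms and the quantization error. Each has second moment
`Δ²/12` and they are pairwise uncorrelated, which gives `3 · Δ²/12`. -/
lemma integral_ditherError_sq (hΔ : 0 < Δ) (a : ℝ) :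
    ∫ t, ditherError Δ a t ^ 2 ∂(triangular Δ) = Δ ^ 2 / 4 := by
  have := isProbabilityMeasure_uniformInterval hΔ
  have hq := measurable_quantizeError Δ
  have hqz : Measurable fun z : ℝ × ℝ => quantizeError Δ (a + (z.1 + z.2)) :=
    hq.comp (by fun_prop)
  rw [integral_triangular Δ ((measurable_ditherError_right Δ a).pow_const 2)]
  set ν := (uniformInterval Δ).prod (uniformInterval Δ) with hν
  have i1 : Integrable (fun z : ℝ × ℝ => z.1 ^ 2) ν :=
    integrable_uniformInterval_prod hΔ (by fun_prop) ((Δ / 2) ^ 2) fun z h _ => by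
      rw [abs_pow]; gcongr
  have i2 : Integrable (fun z : ℝ × ℝ => z.2 ^ 2) ν :=
    integrable_uniformInterval_prod hΔ (by fun_prop) ((Δ / 2) ^ 2) fun z _ h => by
      rw [abs_pow]; gcongr
  have i3 : Integrable (fun z : ℝ × ℝ => quantizeError Δ (a + (z.1 + z.2)) ^ 2) ν :=
    integrable_uniformInterval_prod hΔ (by fun_prop) ((Δ / 2) ^ 2) fun z _ h => by
      rw [abs_pow]; gcongr; exact abs_quantizeError_le hΔ _
  have i4 : Integrable (fun z : ℝ × ℝ => z.1 * z.2) ν :=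
    integrable_uniformInterval_prod hΔ (by fun_prop) ((Δ / 2) * (Δ / 2)) fun z h h' => by
      rw [abs_mul]; gcongr
  have i5 : Integrable (fun z : ℝ × ℝ => z.1 * quantizeError Δ (a + (z.1 + z.2))) ν :=
    integrable_uniformInterval_prod hΔ (by fun_prop) ((Δ / 2) * (Δ / 2)) fun z h h' => by
      rw [abs_mul]; gcongr; exact abs_quantizeError_le hΔ _
  have i6 : Integrable (fun z : ℝ × ℝ => z.2 * quantizeError Δ (a + (z.1 + z.2))) ν :=
    integrable_uniformInterval_prod hΔ (by fun_prop) ((Δ / 2) * (Δ / 2)) fun z h h' => by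
      rw [abs_mul]; gcongr; exact abs_quantizeError_le hΔ _
  have e1 : ∫ z, z.1 ^ 2 ∂ν = Δ ^ 2 / 12 := by
    rw [integral_prod _ i1]; simp [integral_sq_uniformInterval hΔ]
  have e2 : ∫ z, z.2 ^ 2 ∂ν = Δ ^ 2 / 12 := by
    rw [integral_prod _ i2]; simp [integral_sq_uniformInterval hΔ]
  have e3 : ∫ z, quantizeError Δ (a + (z.1 + z.2)) ^ 2 ∂ν = Δ ^ 2 / 12 := by
    rw [integral_prod _ i3]; simp [← add_assoc, integral_quantizeError_sq hΔ]
  have e4 : ∫ z, z.1 * z.2 ∂ν = 0 := by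
    rw [integral_prod _ i4]
    have : ∀ x : ℝ, ∫ y, x * y ∂(uniformInterval Δ) = 0 := fun x => by
      rw [integral_const_mul, integral_id_uniformInterval hΔ, mul_zero]
    simp [this]
  -- With one uniform frozen, the other still averages the sawtooth over a full period. This is the
  -- reason for having two uniforms; the next claim reverses the order of integration.
  have e5 : ∫ z, z.1 * quantizeError Δ (a + (z.1 + z.2)) ∂ν = 0 := by
    rw [integral_prod _ i5]
    simp [← add_assoc, integral_const_mul, integral_quantizeError hΔ]
  have e6 : ∫ z, z.2 * quantizeError Δ (a + (z.1 + z.2)) ∂ν = 0 := by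
    rw [integral_prod_symm _ i6]
    have : ∀ y : ℝ, ∫ x, y * quantizeError Δ (a + (x + y)) ∂(uniformInterval Δ) = 0 := fun y => by
      rw [integral_const_mul]
      have h := integral_quantizeError hΔ (a + y)
      have e : ∀ x, a + (x + y) = a + y + x := fun x => by ring
      simp [e, h]
    simp [this]
  have hexp : ∀ z : ℝ × ℝ, ditherError Δ a (z.1 + z.2) ^ 2 =
      z.1 ^ 2 + (z.2 ^ 2 + (quantizeError Δ (a + (z.1 + z.2)) ^ 2 + (2 * (z.1 * z.2) +
        (2 * (z.1 * quantizeError Δ (a + (z.1 + z.2))) +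
          2 * (z.2 * quantizeError Δ (a + (z.1 + z.2))))))) := fun z => by
    rw [ditherError_eq]; ring
  simp only [hexp]
  have j5 := (i5.const_mul 2).fun_add (i6.const_mul 2)
  have j4 := (i4.const_mul 2).fun_add j5
  have j3 := i3.fun_add j4
  have j2 := i2.fun_add j3
  rw [integral_add i1 j2, integral_add i2 j3, integral_add i3 j4, integral_add (i4.const_mul 2) j5,
    integral_add (i5.const_mul 2) (i6.const_mul 2), integral_const_mul, integral_const_mul,
    integral_const_mul, e1, e2, e3, e4, e5, e6]
  ring

end Dither

/-- The joint law is a product over `ι ⊕ ι`; regrouping its factors in pairs is measure preserving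
and yields a product over `ι`. -/
lemma iIndepFun_prodMk_of_sumElim {ι Ω F : Type*} [Fintype ι] [MeasurableSpace Ω]
    [MeasurableSpace F] {μ : Measure Ω} [IsProbabilityMeasure μ] {x y : ι → Ω → F}
    (hx : ∀ k, Measurable (x k)) (hy : ∀ k, Measurable (y k))
    (h : iIndepFun (Sum.elim x y) μ) : iIndepFun (fun k ω => (x k ω, y k ω)) μ := by
  have hm : ∀ k, Measurable (Sum.elim x y k) := by
    rintro (k | k)
    · exact hx k
    · exact hy k
  have hp : ∀ k, IsProbabilityMeasure (μ.map (Sum.elim x y k)) := fun k =>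
    Measure.isProbabilityMeasure_map (hm k).aemeasurable
  have hp1 : ∀ k, IsProbabilityMeasure (μ.map (x k)) := fun k => hp (.inl k)
  have hp2 : ∀ k, IsProbabilityMeasure (μ.map (y k)) := fun k => hp (.inr k)
  have hpair : ∀ k, μ.map (fun ω => (x k ω, y k ω)) = (μ.map (x k)).prod (μ.map (y k)) := fun k =>
    (h.indepFun (i := .inl k) (j := .inr k) (by simp)).map_prod_eq_prod_map_map
      (hx k).aemeasurable (hy k).aemeasurable
  rw [iIndepFun_iff_map_fun_eq_pi_map fun k => ((hx k).prodMk (hy k)).aemeasurable]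
  have h' := (iIndepFun_iff_map_fun_eq_pi_map fun k => (hm k).aemeasurable).1 h
  have m1 := (measurePreserving_sumPiEquivProdPi_symm
    (X := fun _ : ι ⊕ ι => F) (fun k => μ.map (Sum.elim x y k))).symm
  have m2 := (measurePreserving_arrowProdEquivProdArrow F F ι
    (fun k => μ.map (x k)) (fun k => μ.map (y k))).symm
  simp_rw [hpair]
  have hall : Measurable fun ω i => Sum.elim x y i ω := measurable_pi_iff.2 hm
  have e := (m2.comp m1).map_eq
  rw [← h', Measure.map_map (m2.comp m1).measurable hall] at e
  exact e

/-! ### Dither errors of a vector: second moments and directional fourth moments -/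

section DitherVector

variable {d : ℕ} {Δ : ℝ}

lemma isProbabilityMeasure_triangularDither (d : ℕ) (hΔ : 0 < Δ) :
    IsProbabilityMeasure (triangularDither d Δ) := by
  have := isProbabilityMeasure_triangular hΔ
  rw [triangularDither_eq_pi d hΔ]
  infer_instance

lemma integral_eval_triangularDither (hΔ : 0 < Δ) (i : Fin d) {f : ℝ → ℝ} (hf : Measurable f) :
    ∫ t, f (t i) ∂(triangularDither d Δ) = ∫ s, f s ∂(triangular Δ) := by
  have := isProbabilityMeasure_triangular hΔ
  have h := measurePreserving_eval (fun _ : Fin d => triangular Δ) i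
  rw [triangularDither_eq_pi d hΔ]
  conv_rhs => rw [← h.map_eq]
  rw [integral_map (measurable_pi_apply i).aemeasurable hf.aestronglyMeasurable]

lemma ae_abs_ditherError_eval_le (hΔ : 0 < Δ) (a : Fin d → ℝ) :
    ∀ᵐ t ∂(triangularDither d Δ), ∀ i, |ditherError Δ (a i) (t i)| ≤ 3 * Δ / 2 := by
  have := isProbabilityMeasure_triangular hΔ
  rw [ae_all_iff, triangularDither_eq_pi d hΔ]
  intro i
  exact (Measure.quasiMeasurePreserving_eval (fun _ : Fin d => triangular Δ) i).ae
    (ae_abs_ditherError_le hΔ (a i))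

lemma iIndepFun_ditherError (hΔ : 0 < Δ) (a : Fin d → ℝ) :
    iIndepFun (fun i (t : Fin d → ℝ) => ditherError Δ (a i) (t i)) (triangularDither d Δ) := by
  have := isProbabilityMeasure_triangular hΔ
  rw [triangularDither_eq_pi d hΔ]
  exact iIndepFun_pi (X := fun i s => ditherError Δ (a i) s)
    fun i => (measurable_ditherError_right Δ (a i)).aemeasurable

lemma measurable_ditherError_eval (a : Fin d → ℝ) (i : Fin d) :
    Measurable fun t : Fin d → ℝ => ditherError Δ (a i) (t i) :=
  (measurable_ditherError_right Δ (a i)).comp (measurable_pi_apply i)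

lemma integral_ditherError_eval (hΔ : 0 < Δ) (a : Fin d → ℝ) (i : Fin d) :
    ∫ t, ditherError Δ (a i) (t i) ∂(triangularDither d Δ) = 0 := by
  rw [integral_eval_triangularDither hΔ i (measurable_ditherError_right Δ (a i)),
    integral_ditherError hΔ]

lemma integral_ditherError_mul (hΔ : 0 < Δ) (a : Fin d → ℝ) (i j : Fin d) :
    ∫ t, ditherError Δ (a i) (t i) * ditherError Δ (a j) (t j) ∂(triangularDither d Δ) =
      if i = j then Δ ^ 2 / 4 else 0 := by
  split_ifs with h
  · subst h
    have := integral_eval_triangularDither hΔ i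
      ((measurable_ditherError_right Δ (a i)).pow_const 2)
    rw [integral_ditherError_sq hΔ] at this
    simpa only [pow_two] using this
  · rw [((iIndepFun_ditherError hΔ a).indepFun h).integral_fun_mul_eq_mul_integral
      (measurable_ditherError_eval a i).aestronglyMeasurable
      (measurable_ditherError_eval a j).aestronglyMeasurable, integral_ditherError_eval hΔ,
      zero_mul]

lemma integrable_ditherError_eval (hΔ : 0 < Δ) (a : Fin d → ℝ) (i : Fin d) :
    Integrable (fun t : Fin d → ℝ => ditherError Δ (a i) (t i)) (triangularDither d Δ) := by
  have := isProbabilityMeasure_triangularDither d hΔ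
  refine Integrable.of_bound (measurable_ditherError_eval a i).aestronglyMeasurable
    (3 * Δ / 2) ?_
  filter_upwards [ae_abs_ditherError_eval_le hΔ a] with t ht using ht i

lemma integrable_ditherError_mul (hΔ : 0 < Δ) (a : Fin d → ℝ) (i j : Fin d) :
    Integrable (fun t : Fin d → ℝ => ditherError Δ (a i) (t i) * ditherError Δ (a j) (t j))
      (triangularDither d Δ) :=
  (integrable_ditherError_eval hΔ a j).bdd_mul (c := 3 * Δ / 2)
    (measurable_ditherError_eval a i).aestronglyMeasurable (by
      filter_upwards [ae_abs_ditherError_eval_le hΔ a] with t ht using ht i)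

lemma pow_four_le_exp_add_exp (x : ℝ) : x ^ 4 ≤ 24 * (Real.exp x + Real.exp (-x)) := by
  have h := Real.pow_div_factorial_le_exp |x| (abs_nonneg x) 4
  have e : |x| ^ 4 = x ^ 4 := by rw [← abs_pow, abs_of_nonneg (by positivity)]
  have hf : ((Nat.factorial 4 : ℕ) : ℝ) = 24 := by norm_num [Nat.factorial]
  rw [e, hf] at h
  have h1 := Real.exp_pos x
  have h2 := Real.exp_pos (-x)
  rcases abs_cases x with ⟨h', _⟩ | ⟨h', _⟩ <;> rw [h'] at h <;> linarith

/-- A fourth moment bound for subgaussian random variables. -/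
lemma integral_pow_four_le_of_hasSubgaussianMGF {Ω : Type*} [MeasurableSpace Ω] {μ : Measure Ω}
    {Z : Ω → ℝ} {c : NNReal} (h : HasSubgaussianMGF Z c μ) (hc : 0 < c) :
    Integrable (fun ω => Z ω ^ 4) μ ∧ ∫ ω, Z ω ^ 4 ∂μ ≤ 96 * (c : ℝ) ^ 2 := by
  have hc' : (0 : ℝ) < c := hc
  set b : ℝ := √c with hb
  have hb0 : 0 < b := Real.sqrt_pos.2 hc'
  have hb2 : b ^ 2 = c := Real.sq_sqrt hc'.le
  have hi := ((h.integrable_exp_mul b⁻¹).fun_add (h.integrable_exp_mul (-b⁻¹))).const_mul (24 * b ^ 4)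
  -- Rescaling by `b = √c` makes both moment generating functions at most `e^{1/2} ≤ 2`, so the
  -- constant is `24 · (2 + 2) = 96`.
  have hpt : ∀ ω, Z ω ^ 4 ≤
      24 * b ^ 4 * (Real.exp (b⁻¹ * Z ω) + Real.exp (-b⁻¹ * Z ω)) := fun ω => by
    have := pow_four_le_exp_add_exp (b⁻¹ * Z ω)
    have e : Z ω ^ 4 = b ^ 4 * (b⁻¹ * Z ω) ^ 4 := by field_simp
    rw [e, mul_assoc, mul_left_comm, neg_mul]
    gcongr
  have hZ := h.aestronglyMeasurable
  have hint : Integrable (fun ω => Z ω ^ 4) μ := by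
    refine hi.mono' (hZ.pow 4) (Filter.Eventually.of_forall fun ω => ?_)
    rw [Real.norm_of_nonneg (by positivity)]
    exact hpt ω
  refine ⟨hint, ?_⟩
  have m1 := h.mgf_le b⁻¹
  have m2 := h.mgf_le (-b⁻¹)
  have ex : (c : ℝ) * b⁻¹ ^ 2 / 2 = 1 / 2 := by rw [← hb2]; field_simp
  have he : Real.exp (1 / 2) ≤ 2 := by
    have := Real.exp_one_lt_d9
    have h2 : Real.exp (1 / 2) * Real.exp (1 / 2) = Real.exp 1 := by
      rw [← Real.exp_add]; norm_num
    nlinarith [Real.exp_pos (1 / 2)]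
  rw [neg_sq, ex] at m2
  rw [ex] at m1
  unfold mgf at m1 m2
  calc ∫ ω, Z ω ^ 4 ∂μ
      ≤ ∫ ω, 24 * b ^ 4 * (Real.exp (b⁻¹ * Z ω) + Real.exp (-b⁻¹ * Z ω)) ∂μ :=
        integral_mono hint hi hpt
    _ = 24 * b ^ 4 * (∫ ω, Real.exp (b⁻¹ * Z ω) ∂μ + ∫ ω, Real.exp (-b⁻¹ * Z ω) ∂μ) := by
        rw [integral_const_mul, integral_add (h.integrable_exp_mul _) (h.integrable_exp_mul _)]
    _ ≤ 24 * b ^ 4 * (2 + 2) := by gcongr <;> linarith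
    _ = 96 * (c : ℝ) ^ 2 := by rw [← hb2]; ring

/-- Hoeffding's lemma makes each coordinate subgaussian, and by independence the parameters add to
`(3Δ/2)² ‖v‖²`, with no dependence on `d`. The constant is `96 · (9/4)² = 486`. -/
lemma integral_dotProduct_ditherError_pow_four_le (hΔ : 0 < Δ) (a : Fin d → ℝ) {v : Fin d → ℝ}
    (hv : v ⬝ᵥ v = 1) :
    Integrable (fun t => (∑ i, v i * ditherError Δ (a i) (t i)) ^ 4) (triangularDither d Δ) ∧
    ∫ t, (∑ i, v i * ditherError Δ (a i) (t i)) ^ 4 ∂(triangularDither d Δ) ≤ 486 * Δ ^ 4 := by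
  have := isProbabilityMeasure_triangularDither d hΔ
  have hind : iIndepFun (fun i (t : Fin d → ℝ) => v i * ditherError Δ (a i) (t i))
      (triangularDither d Δ) :=
    (iIndepFun_ditherError hΔ a).comp (fun i s => v i * s) fun i => by fun_prop
  have hsub : ∀ i, HasSubgaussianMGF (fun t : Fin d → ℝ => v i * ditherError Δ (a i) (t i))
      (‖v i‖₊ ^ 2 * (‖3 * Δ / 2 - -(3 * Δ / 2)‖₊ / 2) ^ 2) (triangularDither d Δ) := fun i => by
    have h := (hasSubgaussianMGF_of_mem_Icc_of_integral_eq_zero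
      (measurable_ditherError_eval a i).aemeasurable (by
        filter_upwards [ae_abs_ditherError_eval_le hΔ a] with t ht using abs_le.1 (ht i))
      (integral_ditherError_eval hΔ a i)).const_mul (v i)
    have e : ‖v i‖₊ ^ 2 = (NNReal.mk (v i ^ 2) (sq_nonneg _)) := by
      apply NNReal.eq
      simp
    rw [e]
    exact h
  have h := HasSubgaussianMGF.sum_of_iIndepFun hind (s := Finset.univ) fun i _ => hsub i
  have hcoe : ((∑ i, (‖v i‖₊ ^ 2 * (‖3 * Δ / 2 - -(3 * Δ / 2)‖₊ / 2) ^ 2) : NNReal) : ℝ) =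
      (3 * Δ / 2) ^ 2 := by
    push_cast
    rw [← Finset.sum_mul]
    have e1 : ∑ i, ‖v i‖ ^ 2 = 1 := by rw [← hv]; simp [dotProduct, pow_two]
    have e2 : ‖3 * Δ / 2 - -(3 * Δ / 2)‖ / 2 = 3 * Δ / 2 := by
      rw [Real.norm_of_nonneg (by linarith)]; ring
    rw [e1, e2, one_mul]
  obtain ⟨h1, h2⟩ := integral_pow_four_le_of_hasSubgaussianMGF h (by
    rw [← NNReal.coe_pos]
    refine lt_of_lt_of_eq ?_ hcoe.symm
    positivity)
  refine ⟨h1, h2.trans_eq ?_⟩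
  refine (congrArg (fun y : ℝ => 96 * y ^ 2) hcoe).trans ?_
  ring

end DitherVector

/-! ### Truncation in the `ℓ₄` norm -/

section Truncation

variable {d : ℕ} {ζ : ℝ}

lemma l4norm_nonneg (x : Fin d → ℝ) : 0 ≤ l4norm x :=
  Real.rpow_nonneg (Finset.sum_nonneg fun _ _ => by positivity) _

lemma l4norm_pow_four (x : Fin d → ℝ) : l4norm x ^ 4 = ∑ i, |x i| ^ 4 := by
  unfold l4norm
  rw [← Real.rpow_natCast, ← Real.rpow_mul (Finset.sum_nonneg fun _ _ => by positivity)]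
  norm_num

/-- The case `l4norm x = 0` is included: division by zero makes the factor `0`. -/
lemma truncate_factor_mem (hζ : 0 < ζ) (x : Fin d → ℝ) :
    0 ≤ min (l4norm x) ζ / l4norm x ∧ min (l4norm x) ζ / l4norm x ≤ 1 :=
  ⟨div_nonneg (le_min (l4norm_nonneg x) hζ.le) (l4norm_nonneg x),
    div_le_one_of_le₀ (min_le_left _ _) (l4norm_nonneg x)⟩

lemma dotProduct_truncate (v x : Fin d → ℝ) :
    v ⬝ᵥ truncate ζ x = min (l4norm x) ζ / l4norm x * (v ⬝ᵥ x) := by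
  unfold truncate
  rw [dotProduct_smul, smul_eq_mul]

lemma abs_dotProduct_truncate_le (hζ : 0 < ζ) (v x : Fin d → ℝ) :
    |v ⬝ᵥ truncate ζ x| ≤ |v ⬝ᵥ x| := by
  obtain ⟨h0, h1⟩ := truncate_factor_mem hζ x
  rw [dotProduct_truncate, abs_mul, abs_of_nonneg h0]
  exact mul_le_of_le_one_left (abs_nonneg _) h1

lemma truncate_eq_self (x : Fin d → ℝ) (h : l4norm x ≤ ζ) : truncate ζ x = x := by
  unfold truncate
  rw [min_eq_left h]
  rcases eq_or_ne (l4norm x) 0 with h0 | h0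
  · have hs : ∑ i, |x i| ^ 4 = 0 := by rw [← l4norm_pow_four, h0]; norm_num
    have : x = 0 := by
      funext i
      have := (Finset.sum_eq_zero_iff_of_nonneg fun _ _ => by positivity).1 hs i (Finset.mem_univ i)
      simpa using this
    simp [this]
  · rw [div_self h0, one_smul]

lemma sum_truncate_pow_four_le (hζ : 0 < ζ) (x : Fin d → ℝ) :
    ∑ i, truncate ζ x i ^ 4 ≤ ζ ^ 4 := by
  have e : ∑ i, truncate ζ x i ^ 4 = (min (l4norm x) ζ / l4norm x * l4norm x) ^ 4 := by
    rw [mul_pow, l4norm_pow_four, Finset.mul_sum]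
    refine Finset.sum_congr rfl fun i _ => ?_
    simp only [truncate, Pi.smul_apply, smul_eq_mul, mul_pow]
    rw [← abs_pow, abs_of_nonneg (show (0 : ℝ) ≤ x i ^ 4 by positivity)]
  rw [e]
  have h0 := truncate_factor_mem hζ x
  refine pow_le_pow_left₀ (mul_nonneg h0.1 (l4norm_nonneg x)) ?_ 4
  rcases eq_or_ne (l4norm x) 0 with h | h
  · rw [h, mul_zero]; exact hζ.le
  · rw [div_mul_cancel₀ _ h]; exact min_le_right _ _

/-- Cauchy–Schwarz against the constant vector: passing from `ℓ₄` to `ℓ₂` costs `√d`, not `d`. -/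
lemma sum_truncate_sq_le (hζ : 0 < ζ) (x : Fin d → ℝ) :
    ∑ i, truncate ζ x i ^ 2 ≤ √d * ζ ^ 2 := by
  have h := sum_truncate_pow_four_le hζ x
  have hcs := Finset.sum_mul_sq_le_sq_mul_sq Finset.univ (fun _ : Fin d => (1 : ℝ))
    fun i => truncate ζ x i ^ 2
  simp only [one_mul, one_pow, ← pow_mul, Finset.sum_const, Finset.card_univ, Fintype.card_fin,
    nsmul_eq_mul, mul_one] at hcs
  refine abs_le_of_sq_le_sq' ?_ (by positivity) |>.2
  rw [mul_pow, Real.sq_sqrt (by positivity), ← pow_mul]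
  exact hcs.trans (by gcongr)

lemma abs_truncate_le (hζ : 0 < ζ) (x : Fin d → ℝ) (i : Fin d) : |truncate ζ x i| ≤ ζ := by
  have h := (Finset.single_le_sum (f := fun i => truncate ζ x i ^ 4)
    (fun _ _ => by positivity) (Finset.mem_univ i)).trans (sum_truncate_pow_four_le hζ x)
  refine le_of_pow_le_pow_left₀ (n := 4) (by norm_num) hζ.le ?_
  rwa [← abs_pow, abs_of_nonneg (by positivity)]

lemma measurable_truncate (ζ : ℝ) : Measurable (truncate ζ : (Fin d → ℝ) → Fin d → ℝ) := by
  have hm : Measurable (l4norm : (Fin d → ℝ) → ℝ) := by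
    unfold l4norm
    have : Measurable fun x : Fin d → ℝ => ∑ i, |x i| ^ 4 :=
      Finset.measurable_fun_sum _ fun i _ => ((measurable_pi_apply i).abs.pow_const 4)
    exact this.pow_const _
  unfold truncate
  exact ((hm.min (measurable_const (a := ζ))).div hm).smul measurable_id

/-- The pointwise bound behind the truncation bias. -/
lemma abs_sq_dotProduct_truncate_sub_le (hζ : 0 < ζ) (v x : Fin d → ℝ) {l : ℝ} (hl : 0 < l) :
    |(v ⬝ᵥ truncate ζ x) ^ 2 - (v ⬝ᵥ x) ^ 2| ≤
      l / 2 * |v ⬝ᵥ x| ^ 4 + (2 * l * ζ ^ 4)⁻¹ * ∑ i, |x i| ^ 4 := by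
  rw [← l4norm_pow_four]
  have hN := l4norm_nonneg x
  rcases le_or_gt (l4norm x) ζ with h | h
  · rw [truncate_eq_self x h, sub_self, abs_zero]
    positivity
  · have h1 : (v ⬝ᵥ truncate ζ x) ^ 2 ≤ (v ⬝ᵥ x) ^ 2 := sq_le_sq.2 (abs_dotProduct_truncate_le hζ v x)
    have h2 : |(v ⬝ᵥ truncate ζ x) ^ 2 - (v ⬝ᵥ x) ^ 2| ≤ (v ⬝ᵥ x) ^ 2 := by
      rw [abs_sub_comm, abs_of_nonneg (by linarith)]
      linarith [sq_nonneg (v ⬝ᵥ truncate ζ x)]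
    -- Here `‖x‖₄ > ζ`, so the constant left over by AM-GM may be multiplied by `‖x‖₄⁴ / ζ⁴ ≥ 1`, as
    -- in Markov's inequality.
    have h3 : (2 * l)⁻¹ ≤ (2 * l * ζ ^ 4)⁻¹ * l4norm x ^ 4 := by
      rw [mul_inv (2 * l) (ζ ^ 4), mul_assoc]
      refine le_mul_of_one_le_right (by positivity) ?_
      rw [inv_mul_eq_div, one_le_div (by positivity)]
      exact pow_le_pow_left₀ hζ.le h.le 4
    have h4 : (v ⬝ᵥ x) ^ 2 ≤ l / 2 * |v ⬝ᵥ x| ^ 4 + (2 * l)⁻¹ := by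
      rw [show |v ⬝ᵥ x| ^ 4 = ((v ⬝ᵥ x) ^ 2) ^ 2 by rw [← abs_pow, abs_of_nonneg (by positivity)]; ring]
      have := sq_nonneg (l * (v ⬝ᵥ x) ^ 2 - 1)
      have e : l / 2 * ((v ⬝ᵥ x) ^ 2) ^ 2 + (2 * l)⁻¹ - (v ⬝ᵥ x) ^ 2 =
          (l * (v ⬝ᵥ x) ^ 2 - 1) ^ 2 * (2 * l)⁻¹ := by field_simp; ring
      have := mul_nonneg this (inv_nonneg.2 (by positivity : 0 ≤ 2 * l))
      linarith
    linarith

end Truncation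

/-! ### The quantized sample: size, second and fourth moments -/

section Sample

variable {d : ℕ} {Δ ζ : ℝ}

lemma quantizedSample_eq (x t : Fin d → ℝ) (i : Fin d) :
    quantizedSample Δ ζ x t i = truncate ζ x i + ditherError Δ (truncate ζ x i) (t i) := by
  unfold quantizedSample ditherError
  ring

lemma measurable_quantizedSample (Δ ζ : ℝ) (i : Fin d) :
    Measurable fun z : (Fin d → ℝ) × (Fin d → ℝ) => quantizedSample Δ ζ z.1 z.2 i := by
  unfold quantizedSample
  exact (measurable_quantize Δ).comp
    (((measurable_pi_apply i).comp ((measurable_truncate ζ).comp measurable_fst)).add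
      ((measurable_pi_apply i).comp measurable_snd))

variable {P : Measure (Fin d → ℝ)}

lemma ae_abs_quantizedSample_sub_le (hΔ : 0 < Δ) :
    ∀ᵐ z ∂(P.prod (triangularDither d Δ)), ∀ i,
      |ditherError Δ (truncate ζ z.1 i) (z.2 i)| ≤ 3 * Δ / 2 := by
  have := isProbabilityMeasure_triangularDither d hΔ
  have hm : ∀ i, Measurable fun z : (Fin d → ℝ) × (Fin d → ℝ) =>
      ditherError Δ (truncate ζ z.1 i) (z.2 i) := fun i => by
    have h : Measurable fun z : (Fin d → ℝ) × (Fin d → ℝ) =>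
        quantizedSample Δ ζ z.1 z.2 i - truncate ζ z.1 i :=
      (measurable_quantizedSample Δ ζ i).sub
        ((measurable_pi_apply i).comp ((measurable_truncate ζ).comp measurable_fst))
    simpa only [quantizedSample_eq, add_sub_cancel_left] using h
  have hset : MeasurableSet {z : (Fin d → ℝ) × (Fin d → ℝ) |
      ∀ i, |ditherError Δ (truncate ζ z.1 i) (z.2 i)| ≤ 3 * Δ / 2} := by
    rw [Set.ofPred_forall]
    exact MeasurableSet.iInter fun i => measurableSet_le (hm i).abs measurable_const
  rw [Measure.ae_prod_iff_ae_ae hset]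
  exact Filter.Eventually.of_forall fun x => ae_abs_ditherError_eval_le hΔ (truncate ζ x)

lemma ae_abs_quantizedSample_le (hΔ : 0 < Δ) (hζ : 0 < ζ) :
    ∀ᵐ z ∂(P.prod (triangularDither d Δ)), ∀ i,
      |quantizedSample Δ ζ z.1 z.2 i| ≤ ζ + 3 * Δ / 2 := by
  filter_upwards [ae_abs_quantizedSample_sub_le (ζ := ζ) (P := P) hΔ] with z hz i
  rw [quantizedSample_eq]
  exact (abs_add_le _ _).trans (add_le_add (abs_truncate_le hζ _ i) (hz i))

/-- From `(a + e)² ≤ 2a² + 2e²` with `|e| ≤ 3Δ/2`, summed over the coordinates. -/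
lemma ae_dotProduct_quantizedSample_self_le (hΔ : 0 < Δ) (hζ : 0 < ζ) :
    ∀ᵐ z ∂(P.prod (triangularDither d Δ)),
      quantizedSample Δ ζ z.1 z.2 ⬝ᵥ quantizedSample Δ ζ z.1 z.2 ≤
        2 * (√d * ζ ^ 2) + 9 / 2 * (d * Δ ^ 2) := by
  filter_upwards [ae_abs_quantizedSample_sub_le (ζ := ζ) (P := P) hΔ] with z hz
  have h : ∀ i, quantizedSample Δ ζ z.1 z.2 i * quantizedSample Δ ζ z.1 z.2 i ≤
      2 * truncate ζ z.1 i ^ 2 + 9 / 2 * Δ ^ 2 := fun i => by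
    rw [quantizedSample_eq]
    have h1 := sq_le_sq.2 ((hz i).trans (le_abs_self _))
    nlinarith [sq_nonneg (truncate ζ z.1 i - ditherError Δ (truncate ζ z.1 i) (z.2 i))]
  refine (Finset.sum_le_sum fun i _ => h i).trans ?_
  rw [Finset.sum_add_distrib, ← Finset.mul_sum, Finset.sum_const, Finset.card_univ,
    Fintype.card_fin, nsmul_eq_mul]
  linarith [sum_truncate_sq_le hζ z.1]

variable [IsProbabilityMeasure P]

lemma integrable_quantizedSample_mul (hΔ : 0 < Δ) (hζ : 0 < ζ) (i j : Fin d) :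
    Integrable (fun z => quantizedSample Δ ζ z.1 z.2 i * quantizedSample Δ ζ z.1 z.2 j)
      (P.prod (triangularDither d Δ)) := by
  have := isProbabilityMeasure_triangularDither d hΔ
  refine Integrable.of_bound ((measurable_quantizedSample Δ ζ i).mul
    (measurable_quantizedSample Δ ζ j)).aestronglyMeasurable
    ((ζ + 3 * Δ / 2) * (ζ + 3 * Δ / 2)) ?_
  filter_upwards [ae_abs_quantizedSample_le (P := P) hΔ hζ] with z hz
  rw [norm_mul]
  exact mul_le_mul (hz i) (hz j) (norm_nonneg _) (by positivity)

lemma integrable_truncate_mul (hζ : 0 < ζ) (i j : Fin d) :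
    Integrable (fun x => truncate ζ x i * truncate ζ x j) P := by
  have hm : ∀ i, Measurable fun x : Fin d → ℝ => truncate ζ x i := fun i =>
    (measurable_pi_apply i).comp (measurable_truncate ζ)
  refine Integrable.of_bound ((hm i).mul (hm j)).aestronglyMeasurable (ζ * ζ)
    (Filter.Eventually.of_forall fun x => ?_)
  rw [norm_mul]
  exact mul_le_mul (abs_truncate_le hζ x i) (abs_truncate_le hζ x j) (norm_nonneg _) hζ.le

lemma integral_quantizedSample_mul (hΔ : 0 < Δ) (hζ : 0 < ζ) (i j : Fin d) :
    ∫ z, quantizedSample Δ ζ z.1 z.2 i * quantizedSample Δ ζ z.1 z.2 j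
        ∂(P.prod (triangularDither d Δ)) =
      ∫ x, truncate ζ x i * truncate ζ x j ∂P + if i = j then Δ ^ 2 / 4 else 0 := by
  have := isProbabilityMeasure_triangularDither d hΔ
  rw [integral_prod _ (integrable_quantizedSample_mul hΔ hζ i j)]
  have hin : ∀ x : Fin d → ℝ, ∫ t, quantizedSample Δ ζ x t i * quantizedSample Δ ζ x t j
      ∂(triangularDither d Δ) =
      truncate ζ x i * truncate ζ x j + if i = j then Δ ^ 2 / 4 else 0 := by
    intro x
    set a := truncate ζ x with ha
    -- With `x` fixed, the terms linear in the error average to zero and the product of errors is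
    -- nonzero only on the diagonal.
    have e : ∀ t : Fin d → ℝ, quantizedSample Δ ζ x t i * quantizedSample Δ ζ x t j =
        a i * a j + (a i * ditherError Δ (a j) (t j) + (a j * ditherError Δ (a i) (t i) +
          ditherError Δ (a i) (t i) * ditherError Δ (a j) (t j))) := fun t => by
      rw [quantizedSample_eq, quantizedSample_eq]; ring
    simp only [e]
    have i1 := (integrable_ditherError_eval hΔ a j).const_mul (a i)
    have i2 := (integrable_ditherError_eval hΔ a i).const_mul (a j)
    have i3 := integrable_ditherError_mul hΔ a i j
    rw [integral_add (integrable_const _) (i1.fun_add (i2.fun_add i3)),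
      integral_add i1 (i2.fun_add i3), integral_add i2 i3, integral_const, probReal_univ, one_smul,
      integral_const_mul, integral_const_mul,
      integral_ditherError_eval hΔ, integral_ditherError_eval hΔ, integral_ditherError_mul hΔ]
    simp
  simp only [hin]
  rw [integral_add (integrable_truncate_mul hζ i j) (integrable_const _)]
  simp

lemma add_pow_four_le (a b : ℝ) : (a + b) ^ 4 ≤ 8 * a ^ 4 + 8 * b ^ 4 := by
  have h1 : (a + b) ^ 2 ≤ 2 * (a ^ 2 + b ^ 2) := by nlinarith [sq_nonneg (a - b)]
  have h2 : ((a + b) ^ 2) ^ 2 ≤ (2 * (a ^ 2 + b ^ 2)) ^ 2 := pow_le_pow_left₀ (sq_nonneg _) h1 2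
  nlinarith [sq_nonneg (a ^ 2 - b ^ 2)]

lemma integral_dotProduct_quantizedSample_pow_four_le (hΔ : 0 < Δ) (hζ : 0 < ζ) {M : ℝ}
    {v : Fin d → ℝ} (hv : v ⬝ᵥ v = 1) (hi : Integrable (fun x => |v ⬝ᵥ x| ^ 4) P)
    (hM : ∫ x, |v ⬝ᵥ x| ^ 4 ∂P ≤ M) :
    Integrable (fun z => (v ⬝ᵥ quantizedSample Δ ζ z.1 z.2) ^ 4)
      (P.prod (triangularDither d Δ)) ∧
    ∫ z, (v ⬝ᵥ quantizedSample Δ ζ z.1 z.2) ^ 4 ∂(P.prod (triangularDither d Δ)) ≤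
      8 * (M + 486 * Δ ^ 4) := by
  have := isProbabilityMeasure_triangularDither d hΔ
  have hm : Measurable fun z : (Fin d → ℝ) × (Fin d → ℝ) =>
      v ⬝ᵥ quantizedSample Δ ζ z.1 z.2 :=
    Finset.measurable_fun_sum _ fun i _ => (measurable_quantizedSample Δ ζ i).const_mul (v i)
  have hint : Integrable (fun z => (v ⬝ᵥ quantizedSample Δ ζ z.1 z.2) ^ 4)
      (P.prod (triangularDither d Δ)) := by
    refine Integrable.of_bound (hm.pow_const 4).aestronglyMeasurable
      ((∑ i, |v i| * (ζ + 3 * Δ / 2)) ^ 4) ?_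
    filter_upwards [ae_abs_quantizedSample_le (P := P) hΔ hζ] with z hz
    rw [norm_pow]
    refine pow_le_pow_left₀ (norm_nonneg _) ?_ 4
    refine (norm_sum_le _ _).trans (Finset.sum_le_sum fun i _ => ?_)
    rw [norm_mul]
    exact mul_le_mul_of_nonneg_left (hz i) (norm_nonneg _)
  refine ⟨hint, ?_⟩
  rw [integral_prod _ hint]
  have hb : Integrable (fun x => 8 * |v ⬝ᵥ x| ^ 4 + 8 * (486 * Δ ^ 4)) P :=
    (hi.const_mul 8).add (integrable_const _)
  have hpt : ∀ x : Fin d → ℝ, ∫ t, (v ⬝ᵥ quantizedSample Δ ζ x t) ^ 4 ∂(triangularDither d Δ) ≤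
      8 * |v ⬝ᵥ x| ^ 4 + 8 * (486 * Δ ^ 4) := by
    intro x
    obtain ⟨j1, j2⟩ := integral_dotProduct_ditherError_pow_four_le hΔ (truncate ζ x) hv
    have hle : ∀ t : Fin d → ℝ, (v ⬝ᵥ quantizedSample Δ ζ x t) ^ 4 ≤
        8 * |v ⬝ᵥ x| ^ 4 + 8 * (∑ i, v i * ditherError Δ (truncate ζ x i) (t i)) ^ 4 := by
      intro t
      have e : v ⬝ᵥ quantizedSample Δ ζ x t =
          v ⬝ᵥ truncate ζ x + ∑ i, v i * ditherError Δ (truncate ζ x i) (t i) := by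
        simp only [dotProduct, quantizedSample_eq, mul_add, Finset.sum_add_distrib]
      have h1 : (v ⬝ᵥ truncate ζ x) ^ 4 ≤ |v ⬝ᵥ x| ^ 4 := by
        have := pow_le_pow_left₀ (abs_nonneg _) (abs_dotProduct_truncate_le hζ v x) 4
        rwa [← abs_pow, abs_of_nonneg (by positivity)] at this
      rw [e]
      have h2 := add_pow_four_le (v ⬝ᵥ truncate ζ x)
        (∑ i, v i * ditherError Δ (truncate ζ x i) (t i))
      linarith
    calc ∫ t, (v ⬝ᵥ quantizedSample Δ ζ x t) ^ 4 ∂(triangularDither d Δ)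
        ≤ ∫ t, (8 * |v ⬝ᵥ x| ^ 4 + 8 * (∑ i, v i * ditherError Δ (truncate ζ x i) (t i)) ^ 4)
            ∂(triangularDither d Δ) :=
          integral_mono_of_nonneg (Filter.Eventually.of_forall fun t => by positivity)
            ((integrable_const _).add (j1.const_mul 8)) (Filter.Eventually.of_forall hle)
      _ = 8 * |v ⬝ᵥ x| ^ 4 + 8 * ∫ t, (∑ i, v i * ditherError Δ (truncate ζ x i) (t i)) ^ 4
            ∂(triangularDither d Δ) := by
          rw [integral_add (integrable_const _) (j1.const_mul 8), integral_const, probReal_univ,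
            one_smul, integral_const_mul]
      _ ≤ _ := by gcongr
  refine (integral_mono hint.integral_prod_left hb hpt).trans ?_
  rw [integral_add (hi.const_mul 8) (integrable_const _), integral_const_mul]
  simp
  linarith

end Sample

/-! ### Truncation bias -/

section Bias

variable {d : ℕ} {P : Measure (Fin d → ℝ)} {M ζ : ℝ}

lemma dotProduct_vecMulVec_mulVec {m : Type*} [Fintype m] (y v : m → ℝ) :
    v ⬝ᵥ (Matrix.vecMulVec y y).mulVec v = (v ⬝ᵥ y) ^ 2 := by
  rw [dotProduct_mulVec_eq_sum, pow_two, dotProduct, Finset.sum_mul_sum]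
  refine Finset.sum_congr rfl fun i _ => Finset.sum_congr rfl fun j _ => ?_
  rw [Matrix.vecMulVec_apply]
  ring

lemma dotProduct_single_self (i : Fin d) :
    (Pi.single i 1 : Fin d → ℝ) ⬝ᵥ Pi.single i 1 = 1 := by
  simp

lemma integrable_abs_pow_four
    (hM : ∀ v : Fin d → ℝ, v ⬝ᵥ v = 1 →
      Integrable (fun y => |v ⬝ᵥ y| ^ 4) P ∧ ∫ y, |v ⬝ᵥ y| ^ 4 ∂P ≤ M) (i : Fin d) :
    Integrable (fun y => |y i| ^ 4) P ∧ ∫ y, |y i| ^ 4 ∂P ≤ M := by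
  simpa using hM (Pi.single i 1) (dotProduct_single_self i)

lemma integrable_mul_of_moment [IsProbabilityMeasure P]
    (hM : ∀ v : Fin d → ℝ, v ⬝ᵥ v = 1 →
      Integrable (fun y => |v ⬝ᵥ y| ^ 4) P ∧ ∫ y, |v ⬝ᵥ y| ^ 4 ∂P ≤ M) (i j : Fin d) :
    Integrable (fun y => y i * y j) P := by
  refine (((integrable_const (1 : ℝ)).add (integrable_abs_pow_four hM i).1).add
    (integrable_abs_pow_four hM j).1).mono'
    ((measurable_pi_apply i).mul (measurable_pi_apply j)).aestronglyMeasurable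
    (Filter.Eventually.of_forall fun y => ?_)
  rw [norm_mul, Real.norm_eq_abs, Real.norm_eq_abs]
  simp only [Pi.add_apply]
  nlinarith [sq_nonneg (|y i| ^ 2 - 1), sq_nonneg (|y j| ^ 2 - 1), sq_nonneg (|y i| - |y j|)]

/-- The matrix `E (x̌ x̌ᵀ)` for the truncation `x̌` of a random vector with law `P`. -/
noncomputable def truncatedSecondMoment (ζ : ℝ) (P : Measure (Fin d → ℝ)) :
    Matrix (Fin d) (Fin d) ℝ :=
  Matrix.of fun i j => ∫ x, truncate ζ x i * truncate ζ x j ∂P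

lemma norm_truncatedSecondMoment_sub_le [IsProbabilityMeasure P] (hζ : 0 < ζ) (hd : 0 < d)
    (hM0 : 0 ≤ M) (hM : ∀ v : Fin d → ℝ, v ⬝ᵥ v = 1 →
      Integrable (fun y => |v ⬝ᵥ y| ^ 4) P ∧ ∫ y, |v ⬝ᵥ y| ^ 4 ∂P ≤ M) :
    ‖truncatedSecondMoment ζ P - secondMoment P‖ ≤ M * √d / ζ ^ 2 := by
  have hsym : (truncatedSecondMoment ζ P - secondMoment P).IsHermitian := by
    ext i j
    simp [truncatedSecondMoment, secondMoment, mul_comm]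
  refine norm_le_of_abs_dotProduct_mulVec_le hsym (by positivity) fun v hv => ?_
  have h1 : ∀ i j, Integrable
      (fun x => Matrix.vecMulVec (truncate ζ x) (truncate ζ x) i j) P :=
    integrable_truncate_mul hζ
  have h2 : ∀ i j, Integrable (fun x : Fin d → ℝ => Matrix.vecMulVec x x i j) P :=
    integrable_mul_of_moment hM
  have e1 := integral_dotProduct_mulVec h1 v
  have e2 := integral_dotProduct_mulVec h2 v
  have j1 := integrable_dotProduct_mulVec h1 v
  have j2 := integrable_dotProduct_mulVec h2 v
  simp only [dotProduct_vecMulVec_mulVec] at e1 e2 j1 j2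
  have e : v ⬝ᵥ (truncatedSecondMoment ζ P - secondMoment P).mulVec v =
      ∫ x, ((v ⬝ᵥ truncate ζ x) ^ 2 - (v ⬝ᵥ x) ^ 2) ∂P := by
    rw [integral_sub j1 j2, e1, e2, Matrix.sub_mulVec, dotProduct_sub]
    rfl
  -- The fourth moments of a direction and of all coordinates total at most `M` and `dM`; this `l`
  -- balances the two contributions, each becoming `M√d/(2ζ²)`.
  set l : ℝ := √d / ζ ^ 2 with hl
  have hl0 : 0 < l := by positivity
  have hsum : Integrable (fun x : Fin d → ℝ => ∑ i, |x i| ^ 4) P :=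
    integrable_finsetSum _ fun i _ => (integrable_abs_pow_four hM i).1
  have hsumle : ∫ x : Fin d → ℝ, ∑ i, |x i| ^ 4 ∂P ≤ d * M := by
    rw [integral_finsetSum _ fun i _ => (integrable_abs_pow_four hM i).1]
    refine (Finset.sum_le_sum fun i _ => (integrable_abs_pow_four hM i).2).trans_eq ?_
    simp
  rw [e]
  calc |∫ x, ((v ⬝ᵥ truncate ζ x) ^ 2 - (v ⬝ᵥ x) ^ 2) ∂P|
      ≤ ∫ x, |(v ⬝ᵥ truncate ζ x) ^ 2 - (v ⬝ᵥ x) ^ 2| ∂P := abs_integral_le_integral_abs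
    _ ≤ ∫ x, (l / 2 * |v ⬝ᵥ x| ^ 4 + (2 * l * ζ ^ 4)⁻¹ * ∑ i, |x i| ^ 4) ∂P :=
        integral_mono (j1.sub j2).abs (((hM v hv).1.const_mul _).add (hsum.const_mul _))
          fun x => abs_sq_dotProduct_truncate_sub_le hζ v x hl0
    _ = l / 2 * ∫ x, |v ⬝ᵥ x| ^ 4 ∂P + (2 * l * ζ ^ 4)⁻¹ * ∫ x, ∑ i, |x i| ^ 4 ∂P := by
        rw [integral_add ((hM v hv).1.const_mul _) (hsum.const_mul _), integral_const_mul,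
          integral_const_mul]
    _ ≤ l / 2 * M + (2 * l * ζ ^ 4)⁻¹ * (d * M) := by
        gcongr
        exact (hM v hv).2
    _ = M * √d / ζ ^ 2 := by
        have hdd : (d : ℝ) = √d * √d := (Real.mul_self_sqrt (by positivity)).symm
        have hs : √(d : ℝ) ≠ 0 := by positivity
        rw [hl]
        nth_rw 3 [hdd]
        field_simp
        ring

end Bias

/-! ### Bernstein applied to the centered outer products -/

section Concentration

variable {d : ℕ} {P : Measure (Fin d → ℝ)} {Δ ζ : ℝ}

/-- The matrix `E (ẋ ẋᵀ)` for the quantized sample `ẋ`. -/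
noncomputable def quantizedSecondMoment (Δ ζ : ℝ) (P : Measure (Fin d → ℝ)) :
    Matrix (Fin d) (Fin d) ℝ :=
  Matrix.of fun i j => ∫ z, quantizedSample Δ ζ z.1 z.2 i * quantizedSample Δ ζ z.1 z.2 j
    ∂(P.prod (triangularDither d Δ))

/-- The centered matrix `ẋ ẋᵀ - E (ẋ ẋᵀ)`. -/
noncomputable def centeredOuter (Δ ζ : ℝ) (P : Measure (Fin d → ℝ))
    (z : (Fin d → ℝ) × (Fin d → ℝ)) : Matrix (Fin d) (Fin d) ℝ :=
  Matrix.vecMulVec (quantizedSample Δ ζ z.1 z.2) (quantizedSample Δ ζ z.1 z.2) -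
    quantizedSecondMoment Δ ζ P

lemma isHermitian_centeredOuter (z : (Fin d → ℝ) × (Fin d → ℝ)) :
    (centeredOuter Δ ζ P z).IsHermitian := by
  ext i j
  simp [centeredOuter, quantizedSecondMoment, Matrix.vecMulVec_apply, mul_comm]

lemma measurable_centeredOuter (i j : Fin d) :
    Measurable fun z => centeredOuter Δ ζ P z i j := by
  simp only [centeredOuter, Matrix.sub_apply, Matrix.vecMulVec_apply]
  exact ((measurable_quantizedSample Δ ζ i).mul (measurable_quantizedSample Δ ζ j)).sub
    measurable_const

variable [IsProbabilityMeasure P]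

lemma quantizedSecondMoment_eq (hΔ : 0 < Δ) (hζ : 0 < ζ) :
    quantizedSecondMoment Δ ζ P =
      truncatedSecondMoment ζ P + (Δ ^ 2 / 4) • (1 : Matrix (Fin d) (Fin d) ℝ) := by
  ext i j
  simp only [quantizedSecondMoment, truncatedSecondMoment, Matrix.of_apply, Matrix.add_apply,
    Matrix.smul_apply, Matrix.one_apply, smul_eq_mul, integral_quantizedSample_mul hΔ hζ]
  split_ifs <;> simp

lemma integral_centeredOuter (hΔ : 0 < Δ) (hζ : 0 < ζ) (i j : Fin d) :
    ∫ z, centeredOuter Δ ζ P z i j ∂(P.prod (triangularDither d Δ)) = 0 := by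
  have := isProbabilityMeasure_triangularDither d hΔ
  simp only [centeredOuter, Matrix.sub_apply, Matrix.vecMulVec_apply]
  rw [integral_sub (integrable_quantizedSample_mul hΔ hζ i j) (integrable_const _)]
  simp [quantizedSecondMoment]

lemma ae_norm_centeredOuter_le (hΔ : 0 < Δ) (hζ : 0 < ζ) :
    ∀ᵐ z ∂(P.prod (triangularDither d Δ)),
      ‖centeredOuter Δ ζ P z‖ ≤ 2 * (√d * ζ ^ 2) + 9 / 2 * (d * Δ ^ 2) := by
  have := isProbabilityMeasure_triangularDither d hΔ
  set L := 2 * (√d * ζ ^ 2) + 9 / 2 * (d * Δ ^ 2) with hL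
  have hL0 : 0 ≤ L := by positivity
  have hcs : ∀ v y : Fin d → ℝ, v ⬝ᵥ v = 1 → y ⬝ᵥ y ≤ L → (v ⬝ᵥ y) ^ 2 ≤ L := by
    intro v y hv hy
    have h := Finset.sum_mul_sq_le_sq_mul_sq Finset.univ v y
    have e1 : ∑ i, v i ^ 2 = 1 := by rw [← hv]; simp [dotProduct, pow_two]
    have e2 : ∑ i, y i ^ 2 = y ⬝ᵥ y := by simp [dotProduct, pow_two]
    rw [e1, e2, one_mul] at h
    exact h.trans hy
  have hae := ae_dotProduct_quantizedSample_self_le (P := P) (d := d) hΔ hζ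
  filter_upwards [hae] with z hz
  refine norm_le_of_abs_dotProduct_mulVec_le (isHermitian_centeredOuter z) hL0 fun v hv => ?_
  have hi : ∀ i j, Integrable (fun z => Matrix.vecMulVec (quantizedSample Δ ζ z.1 z.2)
      (quantizedSample Δ ζ z.1 z.2) i j) (P.prod (triangularDither d Δ)) :=
    integrable_quantizedSample_mul hΔ hζ
  have e := integral_dotProduct_mulVec hi v
  have j := integrable_dotProduct_mulVec hi v
  simp only [dotProduct_vecMulVec_mulVec] at e j
  have e' : v ⬝ᵥ (centeredOuter Δ ζ P z).mulVec v = (v ⬝ᵥ quantizedSample Δ ζ z.1 z.2) ^ 2 -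
      ∫ z, (v ⬝ᵥ quantizedSample Δ ζ z.1 z.2) ^ 2 ∂(P.prod (triangularDither d Δ)) := by
    rw [e, centeredOuter, Matrix.sub_mulVec, dotProduct_sub, dotProduct_vecMulVec_mulVec]
    rfl
  have hE0 : 0 ≤ ∫ z, (v ⬝ᵥ quantizedSample Δ ζ z.1 z.2) ^ 2 ∂(P.prod (triangularDither d Δ)) :=
    integral_nonneg fun z => sq_nonneg _
  have hE1 : ∫ z, (v ⬝ᵥ quantizedSample Δ ζ z.1 z.2) ^ 2 ∂(P.prod (triangularDither d Δ)) ≤ L := by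
    have h := integral_mono_ae j (integrable_const L) (by
      filter_upwards [hae] with z hz using hcs v _ hv hz)
    simpa using h
  have h2 := hcs v _ hv hz
  -- The squared projection and its mean both lie in `[0, L]`, so their difference is at most `L`,
  -- without a factor `2`.
  rw [e', abs_le]
  constructor <;> nlinarith [sq_nonneg (v ⬝ᵥ quantizedSample Δ ζ z.1 z.2)]

lemma le_mul_dotProduct_self_of_unit {m : Type*} [Fintype m] {f : (m → ℝ) → ℝ} {q : ℝ}
    (hf : ∀ (c : ℝ) v, f (c • v) = c ^ 2 * f v) (h : ∀ v, v ⬝ᵥ v = 1 → f v ≤ q) (v : m → ℝ) :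
    f v ≤ q * (v ⬝ᵥ v) := by
  have h0 : 0 ≤ v ⬝ᵥ v := Finset.sum_nonneg fun i _ => mul_self_nonneg (v i)
  rcases eq_or_lt_of_le h0 with h1 | h1
  · have hv : v = 0 := dotProduct_self_eq_zero.1 h1.symm
    have := hf 0 0
    simp at this
    simp [hv, this]
  · set s := √(v ⬝ᵥ v) with hs
    have hs0 : 0 < s := Real.sqrt_pos.2 h1
    have hs2 : s ^ 2 = v ⬝ᵥ v := Real.sq_sqrt h0
    have h2 := h (s⁻¹ • v) (by
      rw [smul_dotProduct, dotProduct_smul, ← hs2]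
      simp only [smul_eq_mul]
      field_simp)
    rw [hf, inv_pow, hs2, inv_mul_le_iff₀ h1] at h2
    linarith

/-- Coordinate `i` of the vector is the centered variable `ẋᵢ (v · ẋ)`, so the integral is a sum of
`d` variances. Each is at most `E ẋᵢ² (v · ẋ)²`, hence at most the mean of two directional fourth
moments, and the truncation level never enters. -/
lemma integral_sq_centeredOuter_mulVec_le (hΔ : 0 < Δ) (hζ : 0 < ζ) {M : ℝ}
    (hM : ∀ v : Fin d → ℝ, v ⬝ᵥ v = 1 →
      Integrable (fun y => |v ⬝ᵥ y| ^ 4) P ∧ ∫ y, |v ⬝ᵥ y| ^ 4 ∂P ≤ M) (v : Fin d → ℝ) :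
    ∫ z, (centeredOuter Δ ζ P z).mulVec v ⬝ᵥ (centeredOuter Δ ζ P z).mulVec v
      ∂(P.prod (triangularDither d Δ)) ≤ d * (8 * (M + 486 * Δ ^ 4)) * (v ⬝ᵥ v) := by
  have := isProbabilityMeasure_triangularDither d hΔ
  set ν := P.prod (triangularDither d Δ) with hν
  refine le_mul_dotProduct_self_of_unit (f := fun v => ∫ z, (centeredOuter Δ ζ P z).mulVec v ⬝ᵥ
    (centeredOuter Δ ζ P z).mulVec v ∂ν) (fun c v => ?_) (fun v hv => ?_) v
  · simp only [Matrix.mulVec_smul, smul_dotProduct, dotProduct_smul, smul_eq_mul]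
    rw [integral_const_mul, integral_const_mul]
    ring
  set Z : Fin d → (Fin d → ℝ) × (Fin d → ℝ) → ℝ := fun i z =>
    quantizedSample Δ ζ z.1 z.2 i * (v ⬝ᵥ quantizedSample Δ ζ z.1 z.2) with hZ
  have hZm : ∀ i, Measurable (Z i) := fun i => (measurable_quantizedSample Δ ζ i).mul
    (Finset.measurable_fun_sum _ fun i _ => (measurable_quantizedSample Δ ζ i).const_mul (v i))
  have hZe : ∀ i z, Z i z = ∑ j, v j *
      (quantizedSample Δ ζ z.1 z.2 i * quantizedSample Δ ζ z.1 z.2 j) := fun i z => by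
    simp only [hZ, dotProduct, Finset.mul_sum]
    exact Finset.sum_congr rfl fun j _ => by ring
  have hG : ∀ i z, (centeredOuter Δ ζ P z).mulVec v i = Z i z - ∫ z, Z i z ∂ν := by
    intro i z
    have e : ∫ z, Z i z ∂ν = (quantizedSecondMoment Δ ζ P).mulVec v i := by
      simp only [hZe]
      rw [integral_finsetSum _ fun j _ => (integrable_quantizedSample_mul hΔ hζ i j).const_mul _]
      refine Finset.sum_congr rfl fun j _ => ?_
      rw [integral_const_mul, mul_comm]
      rfl
    rw [e, centeredOuter, Matrix.sub_mulVec, Pi.sub_apply]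
    congr 1
    simp only [hZe, Matrix.mulVec, dotProduct, Matrix.vecMulVec_apply]
    exact Finset.sum_congr rfl fun j _ => by ring
  obtain ⟨hv1, hv2⟩ := integral_dotProduct_quantizedSample_pow_four_le (ζ := ζ) hΔ hζ hv
    (hM v hv).1 (hM v hv).2
  have hsingle : ∀ i : Fin d, Integrable (fun z => quantizedSample Δ ζ z.1 z.2 i ^ 4) ν ∧
      ∫ z, quantizedSample Δ ζ z.1 z.2 i ^ 4 ∂ν ≤ 8 * (M + 486 * Δ ^ 4) := fun i => by
    have h := hM (Pi.single i 1) (dotProduct_single_self i)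
    simpa using integral_dotProduct_quantizedSample_pow_four_le (ζ := ζ) hΔ hζ
      (dotProduct_single_self i) h.1 h.2
  have hZsq : ∀ i z, Z i z ^ 2 ≤ 1 / 2 * (quantizedSample Δ ζ z.1 z.2 i ^ 4 +
      (v ⬝ᵥ quantizedSample Δ ζ z.1 z.2) ^ 4) := fun i z => by
    simp only [hZ]
    nlinarith [sq_nonneg (quantizedSample Δ ζ z.1 z.2 i ^ 2 -
      (v ⬝ᵥ quantizedSample Δ ζ z.1 z.2) ^ 2)]
  have hbi : ∀ i, Integrable (fun z => 1 / 2 * (quantizedSample Δ ζ z.1 z.2 i ^ 4 +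
      (v ⬝ᵥ quantizedSample Δ ζ z.1 z.2) ^ 4)) ν := fun i =>
    ((hsingle i).1.fun_add hv1).const_mul _
  have hZ2 : ∀ i, MemLp (Z i) 2 ν := fun i => by
    rw [memLp_two_iff_integrable_sq (hZm i).aestronglyMeasurable]
    refine (hbi i).mono' ((hZm i).pow_const 2).aestronglyMeasurable
      (Filter.Eventually.of_forall fun z => ?_)
    rw [Real.norm_of_nonneg (sq_nonneg _)]
    exact hZsq i z
  have hvar : ∀ i, ∫ z, (Z i z - ∫ z, Z i z ∂ν) ^ 2 ∂ν ≤ 8 * (M + 486 * Δ ^ 4) := fun i => by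
    rw [← variance_eq_integral (hZm i).aemeasurable]
    refine (variance_le_expectation_sq (hZm i).aestronglyMeasurable).trans ?_
    refine (integral_mono (hZ2 i).integrable_sq (hbi i) (hZsq i)).trans ?_
    rw [integral_const_mul, integral_add (hsingle i).1 hv1]
    linarith [(hsingle i).2]
  have hdot : ∀ z, (centeredOuter Δ ζ P z).mulVec v ⬝ᵥ (centeredOuter Δ ζ P z).mulVec v =
      ∑ i, (Z i z - ∫ z, Z i z ∂ν) ^ 2 := fun z => by
    simp only [dotProduct, hG, pow_two]
  simp only [hdot]
  have hci : ∀ i, Integrable (fun z => (Z i z - ∫ z, Z i z ∂ν) ^ 2) ν := fun i =>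
    ((hZ2 i).sub (memLp_const _)).integrable_sq
  rw [integral_finsetSum _ fun i _ => hci i]
  refine (Finset.sum_le_sum fun i _ => hvar i).trans_eq ?_
  simp

/-- Concentration of the sample second moments of the quantized samples. -/
theorem measure_norm_sum_centeredOuter_ge_le (hΔ : 0 < Δ) (hζ : 0 < ζ) (hd : 0 < d) {M : ℝ}
    (hM0 : 0 ≤ M) (hM : ∀ v : Fin d → ℝ, v ⬝ᵥ v = 1 →
      Integrable (fun y => |v ⬝ᵥ y| ^ 4) P ∧ ∫ y, |v ⬝ᵥ y| ^ 4 ∂P ≤ M)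
    {Ω : Type*} [MeasurableSpace Ω] {μ : Measure Ω} [IsProbabilityMeasure μ] {n : ℕ}
    {ξ : Fin n → Ω → (Fin d → ℝ) × (Fin d → ℝ)} (hξ : iIndepFun ξ μ)
    (hξm : ∀ k, Measurable (ξ k)) (hlaw : ∀ k, μ.map (ξ k) = P.prod (triangularDither d Δ))
    {θ : ℝ} (hθ : 0 < θ) (hθL : θ * (2 * (√d * ζ ^ 2) + 9 / 2 * (d * Δ ^ 2)) ≤ 1) (t : ℝ) :
    μ.real {ω | t ≤ ‖∑ k, θ • centeredOuter Δ ζ P (ξ k ω)‖} ≤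
      2 * d * Real.exp (n * (θ ^ 2 * (d * (8 * (M + 486 * Δ ^ 4)))) - t) := by
  have : Nonempty (Fin d) := ⟨⟨0, hd⟩⟩
  have htr : ∀ k {f : (Fin d → ℝ) × (Fin d → ℝ) → ℝ}, Measurable f →
      ∫ ω, f (ξ k ω) ∂μ = ∫ z, f z ∂(P.prod (triangularDither d Δ)) := fun k f hf => by
    rw [← hlaw k, integral_map (hξm k).aemeasurable hf.aestronglyMeasurable]
  have hb := measure_norm_sum_ge_le (G := fun z => θ • centeredOuter Δ ζ P z)
    (q := θ ^ 2 * (d * (8 * (M + 486 * Δ ^ 4)))) (by positivity) hξ hξm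
    (fun i j => (measurable_centeredOuter i j).const_mul θ)
    (fun z => by
      have := isHermitian_centeredOuter (Δ := Δ) (ζ := ζ) (P := P) z
      rw [Matrix.IsHermitian, Matrix.conjTranspose_smul, this.eq, star_trivial])
    (fun k => by
      have h := ae_norm_centeredOuter_le (P := P) (d := d) hΔ hζ
      rw [← hlaw k] at h
      filter_upwards [ae_of_ae_map (hξm k).aemeasurable h] with ω hω
      rw [norm_smul, Real.norm_of_nonneg hθ.le]
      exact (mul_le_mul_of_nonneg_left hω hθ.le).trans hθL)
    (fun k i j => by
      simp only [Matrix.smul_apply, smul_eq_mul]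
      rw [integral_const_mul, htr k (measurable_centeredOuter i j), integral_centeredOuter hΔ hζ,
        mul_zero])
    (fun k v => by
      have hm : Measurable fun z => (centeredOuter Δ ζ P z).mulVec v ⬝ᵥ
          (centeredOuter Δ ζ P z).mulVec v := by
        have : ∀ i, Measurable fun z => (centeredOuter Δ ζ P z).mulVec v i := fun i => by
          simp only [Matrix.mulVec, dotProduct]
          exact Finset.measurable_fun_sum _ fun j _ => (measurable_centeredOuter i j).mul_const (v j)
        exact Finset.measurable_fun_sum _ fun i _ => (this i).mul (this i)
      simp only [Matrix.smul_mulVec, smul_dotProduct, dotProduct_smul, smul_eq_mul]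
      rw [integral_const_mul, integral_const_mul, htr k hm]
      have := mul_le_mul_of_nonneg_left
        (integral_sq_centeredOuter_mulVec_le (Δ := Δ) (ζ := ζ) hΔ hζ hM v) (sq_nonneg θ)
      linarith) t
  simpa using hb

end Concentration

/-! ### Error decomposition, choice of parameters and conclusion -/

lemma estimator_sub_eq {d n : ℕ} {P : Measure (Fin d → ℝ)} [IsProbabilityMeasure P] {Δ ζ : ℝ}
    (hΔ : 0 < Δ) (hζ : 0 < ζ) (hn : 0 < n) (x τ : Fin n → Fin d → ℝ) :
    estimator Δ ζ x τ - secondMoment P = (1 / (n : ℝ)) • ∑ k, centeredOuter Δ ζ P (x k, τ k) +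
      (truncatedSecondMoment ζ P - secondMoment P) := by
  have hn' : (n : ℝ) ≠ 0 := by positivity
  simp only [centeredOuter]
  rw [Finset.sum_sub_distrib, Finset.sum_const, Finset.card_univ, Fintype.card_fin, smul_sub,
    ← Nat.cast_smul_eq_nsmul ℝ, smul_smul, one_div, inv_mul_cancel₀ hn', one_smul,
    quantizedSecondMoment_eq hΔ hζ]
  unfold estimator
  rw [one_div]
  abel

lemma opNorm_eq_norm {d : ℕ} (A : Matrix (Fin d) (Fin d) ℝ) : opNorm A = ‖A‖ :=
  Matrix.l2_opNorm_toEuclideanCLM A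

/-- The probability bound in terms of an inverse temperature `θ` and a bias bound `b`. -/
lemma measure_opNorm_estimator_sub_ge_le {d n : ℕ} {P : Measure (Fin d → ℝ)}
    [IsProbabilityMeasure P] {Δ ζ M : ℝ} (hΔ : 0 < Δ) (hζ : 0 < ζ) (hd : 0 < d) (hn : 0 < n)
    (hM0 : 0 ≤ M) (hM : ∀ v : Fin d → ℝ, v ⬝ᵥ v = 1 →
      Integrable (fun y => |v ⬝ᵥ y| ^ 4) P ∧ ∫ y, |v ⬝ᵥ y| ^ 4 ∂P ≤ M)
    {Ω : Type*} [MeasurableSpace Ω] {μ : Measure Ω} [IsProbabilityMeasure μ]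
    {x τ : Fin n → Ω → Fin d → ℝ} (hx : ∀ k, HasLaw (x k) P μ)
    (hτ : ∀ k, HasLaw (τ k) (triangularDither d Δ) μ) (hind : iIndepFun (Sum.elim x τ) μ)
    {θ : ℝ} (hθ : 0 < θ) (hθL : θ * (2 * (√d * ζ ^ 2) + 9 / 2 * (d * Δ ^ 2)) ≤ 1) (s : ℝ) :
    μ.real {ω | s ≤ opNorm (estimator Δ ζ (fun k => x k ω) (fun k => τ k ω) - secondMoment P)} ≤
      2 * d * Real.exp (n * (θ ^ 2 * (d * (8 * (M + 486 * Δ ^ 4)))) -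
        θ * (n * (s - M * √d / ζ ^ 2))) := by
  -- `HasLaw` supplies only almost everywhere measurability, while Bernstein asks for measurable
  -- variables; measurable versions change the event by a null set.
  set x' : Fin n → Ω → Fin d → ℝ := fun k => (hx k).aemeasurable.mk (x k) with hx'
  set τ' : Fin n → Ω → Fin d → ℝ := fun k => (hτ k).aemeasurable.mk (τ k) with hτ'
  have hxm : ∀ k, Measurable (x' k) := fun k => (hx k).aemeasurable.measurable_mk
  have hτm : ∀ k, Measurable (τ' k) := fun k => (hτ k).aemeasurable.measurable_mk
  have hxe : ∀ k, x k =ᵐ[μ] x' k := fun k => (hx k).aemeasurable.ae_eq_mk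
  have hτe : ∀ k, τ k =ᵐ[μ] τ' k := fun k => (hτ k).aemeasurable.ae_eq_mk
  have hind' : iIndepFun (Sum.elim x' τ') μ := by
    refine hind.congr ?_
    rintro (k | k)
    · exact hxe k
    · exact hτe k
  have hξ := iIndepFun_prodMk_of_sumElim hxm hτm hind'
  have hlaw : ∀ k, μ.map (fun ω => (x' k ω, τ' k ω)) = P.prod (triangularDither d Δ) := fun k => by
    rw [(hind'.indepFun (i := .inl k) (j := .inr k) (by simp)).map_prod_eq_prod_map_map
      (hxm k).aemeasurable (hτm k).aemeasurable]
    rw [← Measure.map_congr (hxe k), ← Measure.map_congr (hτe k), (hx k).map_eq, (hτ k).map_eq]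
  have hmain := measure_norm_sum_centeredOuter_ge_le (ζ := ζ) hΔ hζ hd hM0 hM hξ
    (fun k => (hxm k).prodMk (hτm k)) hlaw hθ hθL (θ * (n * (s - M * √d / ζ ^ 2)))
  refine le_trans (ENNReal.toReal_mono (measure_ne_top _ _) (measure_mono_ae ?_)) hmain
  filter_upwards [ae_all_iff.2 hxe, ae_all_iff.2 hτe] with ω hω1 hω2 hω
  have hn' : (0 : ℝ) < n := by exact_mod_cast hn
  have hb := norm_truncatedSecondMoment_sub_le (P := P) hζ hd hM0 hM
  have hω' : s ≤ opNorm (estimator Δ ζ (fun k => x k ω) (fun k => τ k ω) - secondMoment P) := hω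
  simp only [hω1, hω2] at hω'
  rw [opNorm_eq_norm, estimator_sub_eq hΔ hζ hn] at hω'
  have h1 := hω'.trans (norm_add_le _ _)
  rw [norm_smul, Real.norm_of_nonneg (by positivity)] at h1
  have h2 : n * (s - M * √d / ζ ^ 2) ≤ ‖∑ k, centeredOuter Δ ζ P (x' k ω, τ' k ω)‖ := by
    have h3 : s - M * √d / ζ ^ 2 ≤ 1 / (n : ℝ) * ‖∑ k, centeredOuter Δ ζ P (x' k ω, τ' k ω)‖ := by
      linarith
    rw [one_div, inv_mul_eq_div, le_div_iff₀ hn'] at h3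
    linarith
  change θ * (n * (s - M * √d / ζ ^ 2)) ≤ ‖∑ k, θ • centeredOuter Δ ζ P (x' k ω, τ' k ω)‖
  rw [← Finset.smul_sum, norm_smul, Real.norm_of_nonneg hθ.le]
  gcongr

/-- Choice of the parameter `θ` in the exponential bound. -/
lemma exists_temperature {c₀ c₁ c₂ : ℝ} (hc₀ : 0 < c₀) (hc₁ : 0 < c₁) (hc₂ : 0 < c₂)
    {d n D δ Δ m u ζ ρ K C : ℝ} (hd : 0 < d) (hn : 0 < n) (hD : 0 < D) (hδ : 0 < δ) (hΔ : 0 < Δ)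
    (hm : 0 ≤ m) (hu : 0 < u) (hu4 : u ^ 4 = n / (δ * D)) (hζ1 : c₁ * ((m + Δ) * u) ≤ ζ)
    (hζ2 : ζ ≤ c₂ * ((m + Δ) * u)) (hn0 : c₀ * (δ * d * D) ≤ n) (hρ : 0 < ρ)
    (hρ2 : ρ ^ 2 = δ * d * D / n) (hK : K = 4 * c₂ ^ 2 + 5 / √c₀ + 63)
    (hC : C = 3 * K + 1 / c₁ ^ 2) :
    ∃ θ : ℝ, 0 < θ ∧ θ * (2 * (√d * ζ ^ 2) + 9 / 2 * (d * Δ ^ 2)) ≤ 1 ∧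
      n * (θ ^ 2 * (d * (8 * (m ^ 4 + 486 * Δ ^ 4)))) -
        θ * (n * (C * max 1 (1 / δ) * ((m ^ 2 + Δ ^ 2) * ρ) - m ^ 4 * √d / ζ ^ 2)) ≤
        -(1 + δ) * D := by
  obtain ⟨R, hR⟩ : ∃ R, R = m ^ 2 + Δ ^ 2 := ⟨_, rfl⟩
  rw [← hR]
  have hR0 : 0 < R := by rw [hR]; positivity
  have hK0 : 63 ≤ K := by rw [hK]; have : 0 ≤ 5 / √c₀ := by positivity
                          linarith only [sq_nonneg c₂, this]
  have hK1 : 0 < K := by linarith only [hK0]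
  have hζ : 0 < ζ := lt_of_lt_of_le (by positivity) hζ1
  have hs : 0 < √d := Real.sqrt_pos.2 hd
  have hs2 : √d * √d = d := Real.mul_self_sqrt hd.le
  -- This identity links the threshold to the rate: since `ζ²` is of order `R u²`, it turns the bias
  -- `R² √d / ζ²` into order `R ρ` and `ρ √d ζ²` into order `R d`.
  have hur : u ^ 2 * ρ = √d := by
    rw [eq_comm, Real.sqrt_eq_iff_mul_self_eq hd.le (by positivity)]
    have : u ^ 2 * ρ * (u ^ 2 * ρ) = u ^ 4 * ρ ^ 2 := by ring
    rw [this, hu4, hρ2]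
    field_simp
  have hs0 : 0 < √c₀ := Real.sqrt_pos.2 hc₀
  have hρc : √c₀ * ρ ≤ 1 := by
    have : (√c₀ * ρ) ^ 2 ≤ 1 := by
      rw [mul_pow, Real.sq_sqrt hc₀.le, hρ2, mul_div_assoc', div_le_one hn]
      exact hn0
    exact (sq_le_one_iff₀ (by positivity)).1 this
  have hζu : ζ ^ 2 ≤ 2 * c₂ ^ 2 * R * u ^ 2 := by
    refine (pow_le_pow_left₀ hζ.le hζ2 2).trans ?_
    have : (m + Δ) ^ 2 ≤ 2 * R := by rw [hR]; linarith only [sq_nonneg (m - Δ)]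
    calc (c₂ * ((m + Δ) * u)) ^ 2 = c₂ ^ 2 * u ^ 2 * (m + Δ) ^ 2 := by ring
      _ ≤ c₂ ^ 2 * u ^ 2 * (2 * R) := by gcongr
      _ = _ := by ring
  have hζl : c₁ ^ 2 * R * u ^ 2 ≤ ζ ^ 2 := by
    refine le_trans ?_ (pow_le_pow_left₀ (by positivity) hζ1 2)
    have : R ≤ (m + Δ) ^ 2 := by rw [hR]; linarith only [mul_nonneg hm hΔ.le]
    calc c₁ ^ 2 * R * u ^ 2 ≤ c₁ ^ 2 * (m + Δ) ^ 2 * u ^ 2 := by gcongr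
      _ = _ := by ring
  have hm4 : m ^ 4 ≤ R ^ 2 := by
    rw [hR]; linarith only [mul_nonneg (sq_nonneg m) (sq_nonneg Δ), sq_nonneg (Δ ^ 2)]
  have hmR : m ^ 4 + 486 * Δ ^ 4 ≤ 486 * R ^ 2 := by
    rw [hR]; linarith only [mul_nonneg (sq_nonneg m) (sq_nonneg Δ), sq_nonneg (m ^ 2)]
  have hbias : m ^ 4 * √d / ζ ^ 2 ≤ R * ρ / c₁ ^ 2 := by
    rw [div_le_div_iff₀ (by positivity) (by positivity)]
    calc m ^ 4 * √d * c₁ ^ 2 ≤ R ^ 2 * (u ^ 2 * ρ) * c₁ ^ 2 := by rw [hur]; gcongr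
      _ = R * ρ * (c₁ ^ 2 * R * u ^ 2) := by ring
      _ ≤ R * ρ * ζ ^ 2 := by gcongr
  have hnρ : n * ρ ^ 2 = δ * d * D := by rw [hρ2]; field_simp
  -- The terms of `K` answer separate demands: `4c₂²` covers the truncation part of the norm bound,
  -- `5/√c₀ ≥ (9/2)/√c₀` its dither part, and `63` the quadratic term of the exponent.
  refine ⟨ρ / (K * R * d), by positivity, ?_, ?_⟩
  · rw [div_mul_eq_mul_div, div_le_one (by positivity)]
    have h1 : ρ * (√d * ζ ^ 2) ≤ 2 * c₂ ^ 2 * R * d := by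
      calc ρ * (√d * ζ ^ 2) ≤ ρ * (√d * (2 * c₂ ^ 2 * R * u ^ 2)) := by gcongr
        _ = 2 * c₂ ^ 2 * R * (√d * (u ^ 2 * ρ)) := by ring
        _ = _ := by rw [hur, hs2]
    have h2 : ρ * (d * Δ ^ 2) ≤ 1 / √c₀ * R * d := by
      have : ρ ≤ 1 / √c₀ := by rw [le_div_iff₀ hs0]; linarith only [hρc]
      calc ρ * (d * Δ ^ 2) ≤ 1 / √c₀ * (d * R) := by
            gcongr
            rw [hR]; linarith only [sq_nonneg m]
        _ = _ := by ring
    have h3 : 0 ≤ 1 / √c₀ * R * d := by positivity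
    have h4 : 0 ≤ R * d := by positivity
    have h5 : K * R * d = 4 * c₂ ^ 2 * R * d + 5 * (1 / √c₀ * R * d) + 63 * (R * d) := by
      rw [hK]; ring
    linarith only [h1, h2, h3, h4, h5]
  · have h1 : n * ((ρ / (K * R * d)) ^ 2 * (d * (8 * (m ^ 4 + 486 * Δ ^ 4)))) ≤ δ * D := by
      calc n * ((ρ / (K * R * d)) ^ 2 * (d * (8 * (m ^ 4 + 486 * Δ ^ 4))))
          ≤ n * ((ρ / (K * R * d)) ^ 2 * (d * (8 * (486 * R ^ 2)))) := by gcongr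
        _ = 3888 * (n * ρ ^ 2) / (K ^ 2 * d) := by field_simp; ring
        _ = 3888 / K ^ 2 * (δ * D) := by rw [hnρ]; field_simp
        _ ≤ 1 * (δ * D) := by
          gcongr
          -- `63² = 3969` exceeds `3888 = 8 · 486`.
          rw [div_le_one (by positivity)]
          nlinarith only [hK0]
        _ = δ * D := one_mul _
    obtain ⟨X, hX⟩ : ∃ X, X = C * max 1 (1 / δ) := ⟨_, rfl⟩
    rw [← hX]
    have h2 : (δ * D) / K * (X - 1 / c₁ ^ 2) ≤
        ρ / (K * R * d) * (n * (X * (R * ρ) - m ^ 4 * √d / ζ ^ 2)) := by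
      calc (δ * D) / K * (X - 1 / c₁ ^ 2) = (n * ρ ^ 2) / (K * d) * (X - 1 / c₁ ^ 2) := by
            rw [hnρ]; field_simp
        _ = ρ / (K * R * d) * (n * (X * (R * ρ) - R * ρ / c₁ ^ 2)) := by field_simp
        _ ≤ _ := by gcongr
    -- The linear term must beat `(1 + 2δ) D`: `δD` for the quadratic term, `δD` for the tail and
    -- `D` for the prefactor `d`. For small `δ` the last part does not shrink, whence the factor
    -- `max 1 (1 / δ)`; then `1 + 2δ ≤ 3 max δ 1` explains the `3K` in `C`.
    have hmax : δ * max 1 (1 / δ) = max δ 1 := by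
      rw [mul_max_of_nonneg _ _ hδ.le, mul_one, mul_one_div_cancel hδ.ne']
    have h3 : K * (1 + 2 * δ) ≤ δ * (X - 1 / c₁ ^ 2) := by
      have e : δ * (X - 1 / c₁ ^ 2) = 3 * K * max δ 1 + 1 / c₁ ^ 2 * (max δ 1 - δ) := by
        rw [hX, ← hmax, hC]; ring
      rw [e]
      have hp : 0 ≤ 1 / c₁ ^ 2 * (max δ 1 - δ) :=
        mul_nonneg (by positivity) (sub_nonneg.2 (le_max_left _ _))
      have hq : K * (1 + 2 * δ) ≤ K * (3 * max δ 1) := by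
        gcongr
        linarith only [le_max_left δ 1, le_max_right δ 1]
      linarith only [hp, hq]
    have h4 : (1 + 2 * δ) * D ≤ (δ * D) / K * (X - 1 / c₁ ^ 2) := by
      calc (1 + 2 * δ) * D = K * (1 + 2 * δ) * (D / K) := by field_simp
        _ ≤ δ * (X - 1 / c₁ ^ 2) * (D / K) := by gcongr
        _ = _ := by ring
    linarith only [h1, h2, h4]

end QCE

theorem theorem3p2 (c₀ c₁ c₂ : ℝ) (hc₀ : 0 < c₀) (hc₁ : 0 < c₁) (hc₂ : 0 < c₂) :
    ∃ C : ℝ, 0 < C ∧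
      ∀ (d n : ℕ) (δ Δ M ζ : ℝ) (P : Measure (Fin d → ℝ))
        (Ω : Type*) [MeasurableSpace Ω] (μ : Measure Ω) [IsProbabilityMeasure μ]
        (x τ : Fin n → Ω → Fin d → ℝ),
        2 ≤ d → 0 < δ → 0 < Δ →
        -- the data have common law `P`, the dithers are triangular, and all are independent
        (∀ k, HasLaw (x k) P μ) →
        (∀ k, HasLaw (τ k) (QCE.triangularDither d Δ) μ) →
        iIndepFun (Sum.elim x τ) μ →
        -- `P` is centered with fourth moments at most `M` in every direction
        (∀ i, ∫ y, y i ∂P = 0) →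
        (∀ v : Fin d → ℝ, v ⬝ᵥ v = 1 →
          Integrable (fun y => |v ⬝ᵥ y| ^ 4) P ∧ ∫ y, |v ⬝ᵥ y| ^ 4 ∂P ≤ M) →
        -- the order of the truncation threshold and the sample size condition
        c₁ * ((M ^ ((1 : ℝ) / 4) + Δ) * (n / (δ * Real.log d)) ^ ((1 : ℝ) / 4)) ≤ ζ →
        ζ ≤ c₂ * ((M ^ ((1 : ℝ) / 4) + Δ) * (n / (δ * Real.log d)) ^ ((1 : ℝ) / 4)) →
        c₀ * (δ * d * Real.log d) ≤ n →
        μ.real {ω | C * max 1 (1 / δ) * ((√M + Δ ^ 2) * √(δ * d * Real.log d / n)) ≤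
            QCE.opNorm (QCE.estimator Δ ζ (fun k => x k ω) (fun k => τ k ω) -
              QCE.secondMoment P)} ≤
          2 * (d : ℝ) ^ (-δ) := by
  refine ⟨3 * (4 * c₂ ^ 2 + 5 / √c₀ + 63) + 1 / c₁ ^ 2, by positivity, ?_⟩
  intro d n δ Δ M ζ P Ω _ μ _ x τ hd hδ hΔ hx hτ hind _ hM hζ1 hζ2 hn0
  have hd0 : 0 < d := by lia
  have hd' : (0 : ℝ) < d := by exact_mod_cast hd0
  have hD : 0 < Real.log d := Real.log_pos (by exact_mod_cast hd)
  have hn' : (0 : ℝ) < n := lt_of_lt_of_le (by positivity) hn0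
  have hn : 0 < n := by exact_mod_cast hn'
  have hP : IsProbabilityMeasure P := by
    rw [← (hx ⟨0, hn⟩).map_eq]
    exact Measure.isProbabilityMeasure_map (hx ⟨0, hn⟩).aemeasurable
  -- Any coordinate direction shows this, and `2 ≤ d` provides one.
  have hM0 : 0 ≤ M :=
    (integral_nonneg fun y => by positivity).trans
      (hM (Pi.single ⟨0, hd0⟩ 1) (QCE.dotProduct_single_self _)).2
  have hrpow : ∀ {a : ℝ}, 0 ≤ a → (a ^ ((1 : ℝ) / 4)) ^ 4 = a := fun {a} ha => by
    rw [← Real.rpow_natCast, ← Real.rpow_mul ha]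
    norm_num
  have hm0 : 0 ≤ M ^ ((1 : ℝ) / 4) := Real.rpow_nonneg hM0 _
  have hsq : √M = (M ^ ((1 : ℝ) / 4)) ^ 2 := by
    rw [Real.sqrt_eq_iff_mul_self_eq hM0 (by positivity), ← pow_add, hrpow hM0]
  have hu : 0 < ((n : ℝ) / (δ * Real.log d)) ^ ((1 : ℝ) / 4) := Real.rpow_pos_of_pos (by positivity) _
  have hζ : 0 < ζ := lt_of_lt_of_le (by positivity) hζ1
  obtain ⟨θ, hθ, hθL, hexp⟩ := QCE.exists_temperature hc₀ hc₁ hc₂ hd' hn' hD hδ hΔ hm0 hu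
    (hrpow (by positivity)) hζ1 hζ2 hn0 (ρ := √(δ * d * Real.log d / n)) (by positivity)
    (Real.sq_sqrt (by positivity)) rfl rfl
  rw [hrpow hM0, ← hsq] at hexp
  refine (QCE.measure_opNorm_estimator_sub_ge_le hΔ hζ hd0 hn hM0 hM hx hτ hind hθ hθL _).trans ?_
  refine (mul_le_mul_of_nonneg_left (Real.exp_le_exp.2 hexp) (by positivity)).trans_eq ?_
  rw [Real.rpow_def_of_pos hd', mul_assoc]
  congr 1
  -- The prefactor `d = e^{log d}` absorbs one `log d` of the exponent, leaving `d^{-δ}`.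
  nth_rw 1 [← Real.exp_log hd']
  rw [← Real.exp_add]
  ring_nf
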